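/- Let $n>2$ be an integer, let $m\in\mathbb{R}$, let $I=(t_*,+\infty)\subset\mathbb{R}$ be an open interval and let $t_0\in I$. Put $a(t)=e^t$, and let $(M,g)$ be the expanding de Sitter universe in flat FLRW form, that is, $M=I\times\mathbb{R}^n$ with the metric $$g=-dt^2+a(t)^2\left((dx^1)^2+\cdots+(dx^n)^2\right).$$ Let $\square_g\phi=\frac{1}{\sqrt{-\det g}}\,\partial_\mu\left(\sqrt{-\det g}\;g^{\mu\nu}\partial_\nu\phi\right)$. Let $k$ be an integer with $k>\frac n2+2$, let $\phi_0\in H^k(\mathbb{R}^n)$ and $\phi_1\in H^{k-1}(\mathbb{R}^n)$ be real-valued, and let $\phi:M\to\mathbb{R}$ be a smooth function with $$\square_g\phi-m^2\phi=0\quad(t\ge t_0,\ \mathbf{x}\in\mathbb{R}^n),\qquad \phi(t_0,\cdot)=\phi_0,\qquad \partial_t\phi(t_0,\cdot)=\phi_1 .$$ Then there is a constant $C$, independent of $t$, such that the following holds. - If $|m|>\frac n2$, then $\|\phi(t,\cdot)\|_{L^\infty(\mathbb{R}^n)}\le C\,a(t)^{-n/2}$ for all $t\ge t_0$. - If $|m|=\frac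 n2$, then $\|\phi(t,\cdot)\|_{L^\infty(\mathbb{R}^n)}\le C\,a(t)^{-n/2}\,(1+|\log a(t)|)$ for all $t\ge t_0$. Consequently, for every $t_1\ge t_0$ with $t_1>0$ there is a constant $C_1$ such that $\|\phi(t,\cdot)\|_{L^\infty(\mathbb{R}^n)}\le C_1\,a(t)^{-n/2}\log a(t)$ for all $t\ge t_1$ (if $t_0>0$ one may take $t_1=t_0$). - If $|m|<\frac n2$, then $\|\phi(t,\cdot)\|_{L^\infty(\mathbb{R}^n)}\le C\,a(t)^{-\frac n2+\sqrt{\frac{n^2}{4}-m^2}}$ for all $t\ge t_0$. -/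

import Mathlib

open MeasureTheory Set
open scoped ContDiff

noncomputable section

namespace DeSitter

/-- Euclidean space `ℝⁿ`. -/
abbrev Space (n : ℕ) : Type := EuclideanSpace ℝ (Fin n)

/-- The coordinate space `ℝ × ℝⁿ` of points `(t, x)`. -/
abbrev Spacetime (n : ℕ) : Type := ℝ × Space n

/-- Labels of the coordinates `(t, x¹, …, xⁿ)`: `Sum.inl ()` is the time coordinate and
`Sum.inr i` is the spatial coordinate number `i`. -/
abbrev Coord (n : ℕ) : Type := Unit ⊕ Fin n

/-- The coordinate vector fields `∂_t, ∂_{x¹}, …, ∂_{xⁿ}`. -/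
def coordVec (n : ℕ) : Coord n → Spacetime n
  | Sum.inl _ => (1, 0)
  | Sum.inr i => (0, EuclideanSpace.single i 1)

/-- The partial derivative `∂_μ f` of a function on spacetime. -/
def pderiv {n : ℕ} (μ : Coord n) (f : Spacetime n → ℝ) (p : Spacetime n) : ℝ :=
  fderiv ℝ f p (coordVec n μ)

/-- The d'Alembertian of a Lorentzian metric with components `g_{μν}` in the coordinates
`(t, x¹, …, xⁿ)`: `□_g φ = (-det g)^{-1/2} ∂_μ ((-det g)^{1/2} g^{μν} ∂_ν φ)`. -/
def dAlembertian {n : ℕ} (g : Spacetime n → Matrix (Coord n) (Coord n) ℝ)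
    (φ : Spacetime n → ℝ) (p : Spacetime n) : ℝ :=
  1 / Real.sqrt (-(g p).det) *
    ∑ μ, pderiv μ (fun q => Real.sqrt (-(g q).det) * ∑ ν, (g q)⁻¹ μ ν * pderiv ν φ q) p

/-- The scale factor `a(t) = eᵗ`. -/
def scaleFactor (t : ℝ) : ℝ := Real.exp t

/-- The de Sitter metric in flat FLRW form,
`g = -dt² + a(t)² ((dx¹)² + ⋯ + (dxⁿ)²)` with `a(t) = eᵗ`. -/
def deSitterMetric (n : ℕ) (p : Spacetime n) : Matrix (Coord n) (Coord n) ℝ :=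
  Matrix.diagonal (Sum.elim (fun _ => -1) (fun _ => scaleFactor p.1 ^ 2))

/-- `v` is the weak derivative `∂_{i 0} ⋯ ∂_{i (j-1)} u` of order `j` on `ℝⁿ`. -/
def IsWeakDeriv {n j : ℕ} (i : Fin j → Fin n) (u v : Space n → ℝ) : Prop :=
  ∀ η : Space n → ℝ, ContDiff ℝ ∞ η → HasCompactSupport η →
    ∫ x, u x * iteratedFDeriv ℝ j η x (fun l => EuclideanSpace.single (i l) 1) =
      (-1) ^ j * ∫ x, v x * η x

/-- The Sobolev space `Hᵏ(ℝⁿ)`: `u` is in `L²` and so are all its weak partial derivatives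
of order at most `k`. -/
def MemH {n : ℕ} (k : ℕ) (u : Space n → ℝ) : Prop :=
  MemLp u 2 volume ∧
    ∀ j ≤ k, ∀ i : Fin j → Fin n, ∃ v : Space n → ℝ, MemLp v 2 volume ∧ IsWeakDeriv i u v

/-- The norm `‖φ(t, ·)‖_{L^∞(ℝⁿ)}`, with value `∞` if `φ(t, ·)` is not essentially bounded. -/
def sliceSupNorm {n : ℕ} (φ : Spacetime n → ℝ) (t : ℝ) : ENNReal :=
  eLpNorm (fun x : Space n => φ (t, x)) ⊤ volume

end DeSitter

end

noncomputable section

namespace DeSitter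

open scoped FourierTransform LineDeriv

/-! Write `φ = e^{-ct} u` with `c + κ = n/2`. Since `√(-det g) = e^{nt}`, the Klein–Gordon equation
becomes `∂ₜ²u + 2κ ∂ₜu + ν²u - e^{-2t} Δu = 0`, where `c² + 2κc + ν² = m²`. A large mass takes `κ =
0`, `ν² = m² - n²/4`; the critical mass takes `κ = ν = 0`; a small mass takes `ν = 0`, `κ² = n²/4 -
m²`, so that `e^{-ct}` is already the claimed rate.

The energy `e^{2λt} ∫ ((∂ₜu)² + e^{-2t}|∇u|² + ν²u²)` does not increase when `λ ≤ 2κ` (the friction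
pays for the weight), `λ ≤ 1` (the redshift of the gradient does) and `λν = 0` (nothing pays for the
mass term). The coefficients depend on `t` alone, so spatial derivatives of `u` obey the same law,
and Sobolev's inequality gives `|∂ₜu| + |ν||u| ≲ e^{-λt}`. With `ν > 0` and `λ = 0` this bounds `u`.
With `ν = 0` one integrates `∂ₜu`: for `λ = 0` there is linear growth in `t`, the logarithm of the
critical case; for `λ = min(2κ, 1) > 0` the bound is integrable and `u` stays bounded.

The field is only assumed smooth at later times, not square integrable. The energy is therefore
localized by a cutoff that shrinks faster than light and equals `1` on a unit ball about an
arbitrary point; because `e^{-t}` is integrable at `+∞`, its support stays in a fixed ball. A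
Sobolev inequality on unit balls, uniform in the centre, then suffices. Carrying lemmas:
`exists_local_sobolev_const`, `exists_isConeWeight`, `pderiv_energy_le`, `IsSolution.exists_bound`,
`isSolution_exp_mul`. -/

/-! ### Spatial derivatives, Sobolev sums and cutoffs -/

/-- The partial derivative `∂_i f` on `ℝⁿ`. -/
def dx {n : ℕ} (i : Fin n) (f : Space n → ℝ) (x : Space n) : ℝ :=
  fderiv ℝ f x (EuclideanSpace.single i 1)

/-- The sum of the squared `L²(A)` norms of iterated partial derivatives of order at most `s`
(with multiplicities). -/
def sobSq {n : ℕ} (A : Set (Space n)) : ℕ → (Space n → ℝ) → ℝ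
  | 0, f => ∫ x in A, f x ^ 2
  | s + 1, f => sobSq A s f + ∑ i, sobSq A s (dx i f)

variable {n : ℕ}

theorem contDiff_dx {f : Space n → ℝ} (hf : ContDiff ℝ ∞ f) (i : Fin n) :
    ContDiff ℝ ∞ (dx i f) := by
  unfold DeSitter.dx
  exact (hf.fderiv_right (m := ∞) (by simp)).clm_apply contDiff_const

theorem hasCompactSupport_dx {f : Space n → ℝ} (hf : HasCompactSupport f) (i : Fin n) :
    HasCompactSupport (dx i f) :=
  hf.fderiv_apply ℝ (EuclideanSpace.single i 1)

theorem dx_add {f g : Space n → ℝ} (hf : ContDiff ℝ ∞ f) (hg : ContDiff ℝ ∞ g) (i : Fin n) :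
    dx i (f + g) = dx i f + dx i g := by
  ext x
  simp only [dx, Pi.add_apply]
  rw [fderiv_add (hf.differentiable (by simp) x) (hg.differentiable (by simp) x)]
  simp

theorem dx_mul {f g : Space n → ℝ} (hf : ContDiff ℝ ∞ f) (hg : ContDiff ℝ ∞ g) (i : Fin n) :
    dx i (f * g) = f * dx i g + dx i f * g := by
  ext x
  simp only [dx, Pi.add_apply, Pi.mul_apply]
  rw [fderiv_mul (hf.differentiable (by simp) x) (hg.differentiable (by simp) x)]
  simp [mul_comm]

theorem sobSq_nonneg (A : Set (Space n)) (s : ℕ) (f : Space n → ℝ) : 0 ≤ sobSq A s f := by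
  induction s generalizing f with
  | zero => exact integral_nonneg fun x => sq_nonneg _
  | succ s ih => exact add_nonneg (ih f) (Finset.sum_nonneg fun i _ => ih _)

theorem integrable_sq_of_hasCompactSupport {f : Space n → ℝ} (hf : ContDiff ℝ ∞ f)
    (hc : HasCompactSupport f) : Integrable fun x => f x ^ 2 := by
  simp only [sq]
  exact (hf.continuous.mul hf.continuous).integrable_of_hasCompactSupport hc.mul_left

theorem sobSq_univ_add_le (s : ℕ) {f g : Space n → ℝ} (hf : ContDiff ℝ ∞ f)
    (hg : ContDiff ℝ ∞ g) (hfc : HasCompactSupport f) (hgc : HasCompactSupport g) :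
    sobSq univ s (f + g) ≤ 2 * sobSq univ s f + 2 * sobSq univ s g := by
  induction s generalizing f g with
  | zero =>
    have h1 := integrable_sq_of_hasCompactSupport hf hfc
    have h2 := integrable_sq_of_hasCompactSupport hg hgc
    simp only [sobSq, Measure.restrict_univ, Pi.add_apply]
    rw [← integral_const_mul, ← integral_const_mul, ← integral_add (h1.const_mul 2)
      (h2.const_mul 2)]
    refine integral_mono (integrable_sq_of_hasCompactSupport (hf.add hg) (hfc.add hgc))
      ((h1.const_mul 2).add (h2.const_mul 2)) fun x => ?_
    simp only
    nlinarith [sq_nonneg (f x - g x)]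
  | succ s ih =>
    simp only [sobSq]
    have h := Finset.sum_le_sum fun i (_ : i ∈ Finset.univ) =>
      ih (contDiff_dx hf i) (contDiff_dx hg i) (hasCompactSupport_dx hfc i)
        (hasCompactSupport_dx hgc i)
    simp only [Finset.sum_add_distrib, ← Finset.mul_sum] at h
    simp only [dx_add hf hg]
    linarith [ih hf hg hfc hgc]

theorem contDiff_translate {η : Space n → ℝ} (hη : ContDiff ℝ ∞ η) (x₀ : Space n) :
    ContDiff ℝ ∞ fun x => η (x - x₀) :=
  hη.comp (contDiff_id.sub contDiff_const)

theorem hasCompactSupport_translate {η : Space n → ℝ} (hη : HasCompactSupport η) (x₀ : Space n) :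
    HasCompactSupport fun x => η (x - x₀) :=
  hη.comp_homeomorph (Homeomorph.subRight x₀)

theorem dx_translate (η : Space n → ℝ) (x₀ : Space n) (i : Fin n) :
    dx i (fun x => η (x - x₀)) = fun x => dx i η (x - x₀) := by
  ext x
  simp only [dx]
  have h := fderiv_comp_add_right (𝕜 := ℝ) (f := η) (x := x) (-x₀)
  simp only [← sub_eq_add_neg] at h
  rw [h]

/-- Leibniz rule by induction on `s`. All cutoffs are translates of one `η`, which is why `C` does
not depend on `x₀`; the induction runs over all `η` because derivatives of `η` appear as new
cutoffs. -/
theorem sobSq_mul_cutoff_le (s : ℕ) {η : Space n → ℝ} (hη : ContDiff ℝ ∞ η)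
    (hsupp : tsupport η ⊆ Metric.closedBall 0 1) :
    ∃ C : ℝ, 0 ≤ C ∧ ∀ (x₀ : Space n) (f : Space n → ℝ), ContDiff ℝ ∞ f →
      sobSq univ s ((fun x => η (x - x₀)) * f) ≤ C * sobSq (Metric.closedBall x₀ 1) s f := by
  have hcpt : ∀ η : Space n → ℝ, tsupport η ⊆ Metric.closedBall 0 1 → HasCompactSupport η :=
    fun η h => (isCompact_closedBall (0 : Space n) 1).of_isClosed_subset (isClosed_tsupport η) h
  induction s generalizing η with
  | zero =>
    obtain ⟨C, hC⟩ := hη.continuous.bounded_above_of_compact_support (hcpt η hsupp)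
    refine ⟨C ^ 2, sq_nonneg _, fun x₀ f hf => ?_⟩
    simp only [sobSq, Measure.restrict_univ, Pi.mul_apply]
    rw [← integral_const_mul, ← integral_indicator (Metric.isClosed_closedBall.measurableSet)]
    refine integral_mono (integrable_sq_of_hasCompactSupport ((contDiff_translate hη x₀).mul hf)
      ((hasCompactSupport_translate (hcpt η hsupp) x₀).mul_right)) ?_ fun x => ?_
    · rw [integrable_indicator_iff Metric.isClosed_closedBall.measurableSet]
      exact ((hf.continuous.pow 2).const_mul _).continuousOn.integrableOn_compact
        (isCompact_closedBall _ _)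
    · by_cases hx : x ∈ Metric.closedBall x₀ 1
      · rw [indicator_of_mem hx]
        simp only [mul_pow]
        have := sq_le_sq' (abs_le.1 (hC (x - x₀))).1 (abs_le.1 (hC (x - x₀))).2
        gcongr
      · rw [indicator_of_notMem hx]
        have : η (x - x₀) = 0 := by
          apply image_eq_zero_of_notMem_tsupport
          intro h
          apply hx
          have := hsupp h
          simpa [dist_eq_norm] using this
        simp [this]
  | succ s ih =>
    obtain ⟨C, hC0, hC⟩ := ih hη hsupp
    have hd : ∀ i : Fin n, tsupport (dx i η) ⊆ Metric.closedBall 0 1 := fun i => by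
      refine (closure_minimal ?_ (isClosed_tsupport η)).trans hsupp
      intro x hx
      by_contra h
      apply hx
      have : fderiv ℝ η x = 0 := by
        have := (notMem_tsupport_iff_eventuallyEq.1 h).fderiv (𝕜 := ℝ)
        simpa using this.self_of_nhds
      simp [dx, this]
    choose D hD0 hD using fun i => ih (contDiff_dx hη i) (hd i)
    have hDs : 0 ≤ ∑ i, D i := Finset.sum_nonneg fun i _ => hD0 i
    refine ⟨2 * C + 2 * ∑ i, D i, by positivity, fun x₀ f hf => ?_⟩
    simp only [sobSq]
    have hη' := contDiff_translate hη x₀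
    have hηc := hasCompactSupport_translate (hcpt η hsupp) x₀
    have key : ∀ i, sobSq univ s (dx i ((fun x => η (x - x₀)) * f)) ≤
        2 * (C * sobSq (Metric.closedBall x₀ 1) s (dx i f)) +
          2 * (D i * sobSq (Metric.closedBall x₀ 1) s f) := fun i => by
      rw [dx_mul hη' hf]
      refine (sobSq_univ_add_le s (hη'.mul (contDiff_dx hf i)) ((contDiff_dx hη' i).mul hf)
        hηc.mul_right ((hasCompactSupport_dx hηc i).mul_right)).trans ?_
      rw [dx_translate]
      exact add_le_add (mul_le_mul_of_nonneg_left (hC x₀ _ (contDiff_dx hf i)) two_pos.le)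
        (mul_le_mul_of_nonneg_left (hD i x₀ f hf) two_pos.le)
    have h := Finset.sum_le_sum fun i (_ : i ∈ Finset.univ) => key i
    simp only [Finset.sum_add_distrib, ← Finset.mul_sum, ← Finset.sum_mul] at h
    have h0 := sobSq_nonneg (Metric.closedBall x₀ 1) s f
    have h1 : 0 ≤ ∑ i, sobSq (Metric.closedBall x₀ 1) s (dx i f) :=
      Finset.sum_nonneg fun i _ => sobSq_nonneg _ _ _
    nlinarith [hC x₀ f hf, mul_nonneg hC0 h0, mul_nonneg hDs h0, mul_nonneg hDs h1]

/-! ### Fourier transform and the Sobolev inequality -/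

theorem fourier_dx {f : Space n → ℝ} (hf : ContDiff ℝ ∞ f) (hc : HasCompactSupport f)
    (i : Fin n) (ξ : Space n) :
    𝓕 (fun x => (dx i f x : ℂ)) ξ =
      2 * Real.pi * Complex.I * (ξ i : ℂ) * 𝓕 (fun x => (f x : ℂ)) ξ := by
  have hc' : HasCompactSupport fun x => (f x : ℂ) := hc.comp_left (g := Complex.ofReal) (by simp)
  have hf' : ContDiff ℝ ∞ fun x => (f x : ℂ) := Complex.ofRealCLM.contDiff.comp hf
  have h := SchwartzMap.fourier_lineDerivOp_eq (hc'.toSchwartzMap hf')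
    (EuclideanSpace.single i (1 : ℝ))
  have h2 := congrArg (fun g => g ξ) h
  have ht : (fun x : Space n => inner ℝ x (EuclideanSpace.single i (1 : ℝ))).HasTemperateGrowth := by
    fun_prop
  simp only [SchwartzMap.fourier_coe, _root_.smul_apply,
    SchwartzMap.smulLeftCLM_apply_apply ht] at h2
  have h3 : ((∂_{EuclideanSpace.single i (1 : ℝ)} (hc'.toSchwartzMap hf') :
      SchwartzMap (Space n) ℂ) : Space n → ℂ) = fun x => (dx i f x : ℂ) := by
    ext x
    rw [SchwartzMap.lineDerivOp_apply_eq_fderiv]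
    have := (Complex.ofRealCLM.hasFDerivAt.comp x
      (hf.differentiable (by simp) x).hasFDerivAt).fderiv
    change fderiv ℝ (Complex.ofRealCLM ∘ f) x _ = _
    rw [this]
    simp [dx]
  rw [h3] at h2
  rw [h2]
  have h4 : inner ℝ ξ (EuclideanSpace.single i (1 : ℝ)) = ξ i := by
    simp [EuclideanSpace.inner_single_right]
  have h5 : ⇑(hc'.toSchwartzMap hf') = fun x => (f x : ℂ) := rfl
  rw [h4, h5, Complex.real_smul, smul_eq_mul]
  ring

/-- Plancherel. The multiplicities in `sobSq` make the weight an exact power: each step multiplies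
it by `1 + ∑ (2π ξᵢ)² = 1 + 4π²‖ξ‖²`. -/
theorem integral_fourier_weight {f : Space n → ℝ} (hf : ContDiff ℝ ∞ f)
    (hc : HasCompactSupport f) (s : ℕ) :
    (Integrable fun ξ : Space n =>
      (1 + 4 * Real.pi ^ 2 * ‖ξ‖ ^ 2) ^ s * ‖𝓕 (fun x => (f x : ℂ)) ξ‖ ^ 2) ∧
    ∫ ξ : Space n, (1 + 4 * Real.pi ^ 2 * ‖ξ‖ ^ 2) ^ s * ‖𝓕 (fun x => (f x : ℂ)) ξ‖ ^ 2 =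
      sobSq univ s f := by
  induction s generalizing f with
  | zero =>
    have hc' : HasCompactSupport fun x => (f x : ℂ) :=
      hc.comp_left (g := Complex.ofReal) (by simp)
    have hf' : ContDiff ℝ ∞ fun x => (f x : ℂ) := Complex.ofRealCLM.contDiff.comp hf
    have h := SchwartzMap.integral_norm_sq_fourier (hc'.toSchwartzMap hf')
    have hi := ((𝓕 (hc'.toSchwartzMap hf')).memLp 2).integrable_norm_pow (by simp)
    simp only [SchwartzMap.fourier_coe] at h hi
    simp only [pow_zero, one_mul, sobSq, Measure.restrict_univ]
    refine ⟨hi, h.trans ?_⟩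
    refine integral_congr_ae (Filter.Eventually.of_forall fun x => ?_)
    change ‖((f x : ℝ) : ℂ)‖ ^ 2 = f x ^ 2
    simp
  | succ s ih =>
    have hrw : ∀ ξ : Space n, (1 + 4 * Real.pi ^ 2 * ‖ξ‖ ^ 2) ^ (s + 1) *
        ‖𝓕 (fun x => (f x : ℂ)) ξ‖ ^ 2 =
        (1 + 4 * Real.pi ^ 2 * ‖ξ‖ ^ 2) ^ s * ‖𝓕 (fun x => (f x : ℂ)) ξ‖ ^ 2 +
        ∑ i, (1 + 4 * Real.pi ^ 2 * ‖ξ‖ ^ 2) ^ s * ‖𝓕 (fun x => (dx i f x : ℂ)) ξ‖ ^ 2 := by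
      intro ξ
      simp only [fourier_dx hf hc, norm_mul, mul_pow]
      simp only [Complex.norm_real, Complex.norm_I, Real.norm_eq_abs, sq_abs]
      rw [← Finset.mul_sum, ← Finset.sum_mul, ← Finset.mul_sum]
      have : ‖ξ‖ ^ 2 = ∑ i, ξ i ^ 2 := by
        rw [EuclideanSpace.norm_sq_eq]; simp
      rw [← this]
      norm_num
      ring
    have h0 := ih hf hc
    have h1 := fun i => ih (contDiff_dx hf i) (hasCompactSupport_dx hc i)
    simp only [hrw, sobSq]
    refine ⟨h0.1.add (integrable_finsetSum _ fun i _ => (h1 i).1), ?_⟩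
    rw [integral_add h0.1 (integrable_finsetSum _ fun i _ => (h1 i).1), h0.2,
      integral_finsetSum _ fun i _ => (h1 i).1]
    simp only [(h1 _).2]

/-- Fourier inversion gives `|f x| ≤ ∫ ‖f̂‖`; Cauchy–Schwarz against the weight of order `s` leaves
`∫ (1 + 4π²‖ξ‖²)^{-s}`, which converges since `2s > n`. -/
theorem exists_sobolev_const_of_hasCompactSupport {s : ℕ} (hs : (n : ℝ) < 2 * s) :
    ∃ C : ℝ, 0 ≤ C ∧ ∀ f : Space n → ℝ, ContDiff ℝ ∞ f → HasCompactSupport f →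
      ∀ x, f x ^ 2 ≤ C * sobSq univ s f := by
  have hint : Integrable fun ξ : Space n => ((1 : ℝ) + 4 * Real.pi ^ 2 * ‖ξ‖ ^ 2) ^ (-(s : ℝ)) := by
    have h0 := integrable_rpow_neg_one_add_norm_sq (E := Space n) (μ := volume) (r := 2 * s)
      (by simpa using hs)
    refine h0.mono' (by apply Measurable.aestronglyMeasurable; fun_prop) (Filter.Eventually.of_forall fun ξ => ?_)
    rw [Real.norm_of_nonneg (by positivity)]
    have e : -(2 * (s : ℝ)) / 2 = -(s : ℝ) := by ring
    rw [e]
    refine Real.rpow_le_rpow_of_nonpos (by positivity) ?_ (by simp)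
    have : 1 ≤ 4 * Real.pi ^ 2 := by nlinarith [Real.pi_gt_three]
    nlinarith [sq_nonneg ‖ξ‖]
  set K := ∫ ξ : Space n, ((1 : ℝ) + 4 * Real.pi ^ 2 * ‖ξ‖ ^ 2) ^ (-(s : ℝ)) with hK
  have hK0 : 0 ≤ K := integral_nonneg fun ξ => by positivity
  refine ⟨K, hK0, fun f hf hc x => ?_⟩
  have hc' : HasCompactSupport fun x => (f x : ℂ) := hc.comp_left (g := Complex.ofReal) (by simp)
  have hf' : ContDiff ℝ ∞ fun x => (f x : ℂ) := Complex.ofRealCLM.contDiff.comp hf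
  set g := 𝓕 (fun x => (f x : ℂ)) with hg
  have hgi : Integrable g := by
    have := (𝓕 (hc'.toSchwartzMap hf')).integrable (μ := volume)
    rwa [SchwartzMap.fourier_coe] at this
  have hinv : (f x : ℂ) = 𝓕⁻ g x :=
    (congrFun (Continuous.fourierInv_fourier_eq hf'.continuous
      ((hc'.toSchwartzMap hf').integrable) hgi) x).symm
  have hle : |f x| ≤ ∫ ξ, ‖g ξ‖ := by
    have : |f x| = ‖(f x : ℂ)‖ := by simp
    rw [this, hinv, Real.fourierInv_eq]
    refine (norm_integral_le_integral_norm _).trans (le_of_eq ?_)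
    simp
  obtain ⟨hwi, hw⟩ := integral_fourier_weight hf hc s
  rw [← hg] at hwi hw
  -- Cauchy–Schwarz in its pointwise form: AM–GM with a free parameter `ε`, optimized afterwards.
  have hCS : ∀ ε : ℝ, 0 < ε → |f x| ≤ ε * K + (4 * ε)⁻¹ * sobSq univ s f := fun ε hε => by
    refine hle.trans ?_
    rw [hK, ← hw, ← integral_const_mul, ← integral_const_mul,
      ← integral_add (hint.const_mul _) (hwi.const_mul _)]
    refine integral_mono hgi.norm ((hint.const_mul _).add (hwi.const_mul _)) fun ξ => ?_
    simp only
    set W := (1 + 4 * Real.pi ^ 2 * ‖ξ‖ ^ 2) with hW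
    have hWp : 0 < W ^ s := by positivity
    have : W ^ (-(s : ℝ)) = (W ^ s)⁻¹ := by
      rw [Real.rpow_neg (by positivity), Real.rpow_natCast]
    rw [this]
    set V := W ^ s
    have e : ε * V⁻¹ + (4 * ε)⁻¹ * (V * ‖g ξ‖ ^ 2) - ‖g ξ‖ =
        (4 * ε * V)⁻¹ * (2 * ε - V * ‖g ξ‖) ^ 2 := by
      field_simp
      ring
    have : 0 ≤ (4 * ε * V)⁻¹ * (2 * ε - V * ‖g ξ‖) ^ 2 := by positivity
    linarith
  -- The choice `ε = |f x| / (2(K + δ))` is optimal up to `δ`, which avoids proving `K ≠ 0` and is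
  -- then sent to zero.
  have hKpos : ∀ δ : ℝ, 0 < δ → f x ^ 2 ≤ (K + δ) * sobSq univ s f := fun δ hδ => by
    by_cases hfx : f x = 0
    · rw [hfx]; have := sobSq_nonneg univ s f; simp only [ne_eq, OfNat.ofNat_ne_zero, not_false_eq_true, zero_pow]; positivity
    have hfp : 0 < |f x| := abs_pos.2 hfx
    have h := hCS (|f x| / (2 * (K + δ))) (by positivity)
    have e1 : |f x| / (2 * (K + δ)) * K ≤ |f x| / 2 := by
      rw [div_mul_eq_mul_div, div_le_div_iff₀ (by positivity) (by norm_num)]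
      nlinarith
    have e2 : (4 * (|f x| / (2 * (K + δ))))⁻¹ * sobSq univ s f =
        (K + δ) * sobSq univ s f / (2 * |f x|) := by
      field_simp
      norm_num
    rw [e2] at h
    have h3 : |f x| / 2 ≤ (K + δ) * sobSq univ s f / (2 * |f x|) := by linarith
    rw [div_le_div_iff₀ (by norm_num) (by positivity)] at h3
    rw [← sq_abs]
    nlinarith
  refine le_of_forall_pos_le_add fun ε hε => ?_
  have hS := sobSq_nonneg univ s f
  refine (hKpos (ε / (sobSq univ s f + 1)) (by positivity)).trans ?_
  rw [add_mul, div_mul_eq_mul_div]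
  gcongr
  rw [div_le_iff₀ (by positivity)]
  nlinarith

/-- **Local Sobolev inequality**, uniform in the centre of the ball. -/
theorem exists_local_sobolev_const {s : ℕ} (hs : (n : ℝ) < 2 * s) :
    ∃ C : ℝ, 0 ≤ C ∧ ∀ f : Space n → ℝ, ContDiff ℝ ∞ f →
      ∀ x, f x ^ 2 ≤ C * sobSq (Metric.closedBall x 1) s f := by
  obtain ⟨C, hC0, hC⟩ := exists_sobolev_const_of_hasCompactSupport hs
  let η : ContDiffBump (0 : Space n) := ⟨1 / 2, 1, by norm_num, by norm_num⟩
  obtain ⟨D, hD0, hD⟩ := sobSq_mul_cutoff_le s (η := η) η.contDiff η.tsupport_eq.le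
  refine ⟨C * D, by positivity, fun f hf x => ?_⟩
  have h := hC ((fun y => η (y - x)) * f) ((contDiff_translate η.contDiff x).mul hf)
    ((hasCompactSupport_translate η.hasCompactSupport x).mul_right) x
  have h1 : η (0 : Space n) = 1 := η.one_of_mem_closedBall (by simp; norm_num)
  simp only [Pi.mul_apply, sub_self, h1, one_mul] at h
  refine h.trans ?_
  rw [mul_assoc]
  gcongr
  exact hD x f hf

/-! ### Sobolev regularity of smooth functions -/

/-- `f` and its iterated partial derivatives of order at most `s` are square integrable. -/
def MemHs {n : ℕ} : ℕ → (Space n → ℝ) → Prop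
  | 0, f => MemLp f 2 volume
  | s + 1, f => MemHs s f ∧ ∀ i, MemHs s (dx i f)

theorem MemHs.add {s : ℕ} {f g : Space n → ℝ} (hf : ContDiff ℝ ∞ f) (hg : ContDiff ℝ ∞ g)
    (h : MemHs s f) (h' : MemHs s g) : MemHs s (f + g) := by
  induction s generalizing f g with
  | zero => exact MemLp.add h h'
  | succ s ih =>
    refine ⟨ih hf hg h.1 h'.1, fun i => ?_⟩
    rw [dx_add hf hg]
    exact ih (contDiff_dx hf i) (contDiff_dx hg i) (h.2 i) (h'.2 i)

theorem dx_const_smul {f : Space n → ℝ} (hf : ContDiff ℝ ∞ f) (c : ℝ) (i : Fin n) :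
    dx i (c • f) = c • dx i f := by
  ext x
  simp only [dx, Pi.smul_apply]
  rw [fderiv_const_smul (hf.differentiable (by simp) x)]
  rfl

theorem MemHs.const_smul {s : ℕ} {f : Space n → ℝ} (hf : ContDiff ℝ ∞ f) (h : MemHs s f)
    (c : ℝ) : MemHs s (c • f) := by
  induction s generalizing f with
  | zero => exact MemLp.const_smul h c
  | succ s ih =>
    refine ⟨ih hf h.1, fun i => ?_⟩
    rw [dx_const_smul hf]
    exact ih (contDiff_dx hf i) (h.2 i)

theorem sobSq_le_univ {s : ℕ} {f : Space n → ℝ} (h : MemHs s f) (A : Set (Space n)) :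
    sobSq A s f ≤ sobSq univ s f := by
  induction s generalizing f with
  | zero =>
    simp only [sobSq, Measure.restrict_univ]
    exact setIntegral_le_integral (MemLp.integrable_sq h)
      (Filter.Eventually.of_forall fun x => sq_nonneg _)
  | succ s ih =>
    exact add_le_add (ih h.1) (Finset.sum_le_sum fun i _ => ih (h.2 i))

theorem MemHs.bounded {s : ℕ} (hs : (n : ℝ) < 2 * s) {f : Space n → ℝ} (hf : ContDiff ℝ ∞ f)
    (h : MemHs s f) : ∃ C : ℝ, ∀ x, |f x| ≤ C := by
  obtain ⟨C, hC0, hC⟩ := exists_local_sobolev_const hs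
  refine ⟨Real.sqrt (C * sobSq univ s f), fun x => Real.abs_le_sqrt ((hC f hf x).trans ?_)⟩
  exact mul_le_mul_of_nonneg_left (sobSq_le_univ h _) hC0

theorem integral_mul_dx {f g : Space n → ℝ} (hf : ContDiff ℝ ∞ f) (hg : ContDiff ℝ ∞ g)
    (hc : HasCompactSupport g) (i : Fin n) :
    ∫ x, f x * dx i g x = -∫ x, dx i f x * g x :=
  integral_mul_fderiv_eq_neg_fderiv_mul_of_integrable
    (((contDiff_dx hf i).continuous.mul hg.continuous).integrable_of_hasCompactSupport hc.mul_left)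
    ((hf.continuous.mul (contDiff_dx hg i).continuous).integrable_of_hasCompactSupport
      (hasCompactSupport_dx hc i).mul_left)
    ((hf.continuous.mul hg.continuous).integrable_of_hasCompactSupport hc.mul_left)
    (fun x _ => hf.differentiable (by simp) x) (fun x _ => hg.differentiable (by simp) x)

theorem integral_dx_eq_zero {g : Space n → ℝ} (hg : ContDiff ℝ ∞ g)
    (hc : HasCompactSupport g) (i : Fin n) : ∫ x, dx i g x = 0 := by
  have h := integral_mul_dx (f := fun _ => (1 : ℝ)) contDiff_const hg hc i
  have h1 : dx i (fun _ : Space n => (1 : ℝ)) = 0 := by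
    ext x
    simp [dx]
  simpa [h1] using h

/-- Integration by parts shows that the classical derivative of a smooth function is its weak
derivative almost everywhere, so the abstract `L²` representative can be replaced by `dx i f`. -/
theorem memH_dx {k : ℕ} {f : Space n → ℝ} (hf : ContDiff ℝ ∞ f) (h : MemH (k + 1) f)
    (i : Fin n) : MemH k (dx i f) := by
  constructor
  · obtain ⟨v, hv, hw⟩ := h.2 1 (by omega) (fun _ => i)
    refine (memLp_congr_ae ?_).2 hv
    refine ae_eq_of_integral_contDiff_smul_eq
      (contDiff_dx hf i).continuous.locallyIntegrable
      (hv.locallyIntegrable (by norm_num)) fun η hη hηc => ?_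
    have h1 := hw η hη hηc
    simp only [iteratedFDeriv_one_apply] at h1
    have h2 := integral_mul_dx hf hη hηc i
    simp only [dx] at h2 ⊢
    rw [h2] at h1
    simp only [smul_eq_mul, mul_comm (η _)]
    linarith
  · intro j hj i'
    -- The direction `i` goes first because the outermost derivative of `iteratedFDeriv` is the one
    -- integrated by parts; the sign this costs turns `(-1)^(j+1)` into `(-1)^j`.
    obtain ⟨v, hv, hw⟩ := h.2 (j + 1) (by omega) (Fin.cons i i')
    refine ⟨v, hv, fun η hη hηc => ?_⟩
    have h1 := hw η hη hηc
    set e : Fin j → Space n := fun l => EuclideanSpace.single (i' l) 1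
    have hD : ContDiff ℝ ∞ (iteratedFDeriv ℝ j η) := hη.iteratedFDeriv_right (by exact_mod_cast le_top)
    have hg : ContDiff ℝ ∞ fun x => iteratedFDeriv ℝ j η x e :=
      (ContinuousMultilinearMap.apply ℝ (fun _ : Fin j => Space n) ℝ e).contDiff.comp hD
    have hgc : HasCompactSupport fun x => iteratedFDeriv ℝ j η x e :=
      (hηc.iteratedFDeriv j).comp_left
        (g := fun L : ContinuousMultilinearMap ℝ (fun _ : Fin j => Space n) ℝ => L e) (by simp)
    have h3 := integral_mul_dx hf hg hgc i
    have h4 : ∀ x, iteratedFDeriv ℝ (j + 1) η x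
        (fun l => EuclideanSpace.single ((Fin.cons i i' : Fin (j + 1) → Fin n) l) 1) =
        dx i (fun x => iteratedFDeriv ℝ j η x e) x := fun x => by
      rw [iteratedFDeriv_succ_apply_left]
      simp only [dx]
      rw [fderiv_continuousMultilinear_apply_const_apply (hD.differentiable (by simp) x)]
      rfl
    simp only [h4] at h1
    rw [h3, pow_succ] at h1
    linarith

theorem MemHs.of_memH {k : ℕ} {f : Space n → ℝ} (hf : ContDiff ℝ ∞ f) (h : MemH k f) :
    MemHs k f := by
  induction k generalizing f with
  | zero => exact h.1
  | succ k ih =>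
    exact ⟨ih hf ⟨h.1, fun j hj => h.2 j (by omega)⟩,
      fun i => ih (contDiff_dx hf i) (memH_dx hf h i)⟩

/-! ### Spacetime derivatives and the rescaled equation -/

theorem contDiff_pderiv {u : Spacetime n → ℝ} (hu : ContDiff ℝ ∞ u) (μ : Coord n) :
    ContDiff ℝ ∞ (pderiv μ u) := by
  unfold pderiv
  exact (hu.fderiv_right (m := ∞) (by simp)).clm_apply contDiff_const

theorem pderiv_comm {u : Spacetime n → ℝ} (hu : ContDiff ℝ ∞ u) (μ ν : Coord n) :
    pderiv μ (pderiv ν u) = pderiv ν (pderiv μ u) := by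
  ext p
  have hd : DifferentiableAt ℝ (fderiv ℝ u) p :=
    (hu.fderiv_right (m := ∞) (by simp)).differentiable (by simp) p
  have key : ∀ v w : Spacetime n,
      fderiv ℝ (fun q => fderiv ℝ u q w) p v = fderiv ℝ (fderiv ℝ u) p v w := fun v w => by
    rw [fderiv_clm_apply hd (differentiableAt_const w)]
    simp
  have h := ((contDiff_infty.1 hu 2).contDiffAt (x := p)).isSymmSndFDerivAt (by simp)
  unfold pderiv
  rw [key, key]
  exact h _ _

theorem contDiff_slice {u : Spacetime n → ℝ} (hu : ContDiff ℝ ∞ u) (t : ℝ) :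
    ContDiff ℝ ∞ fun x => u (t, x) :=
  hu.comp (contDiff_const.prodMk contDiff_id)

theorem dx_slice {u : Spacetime n → ℝ} (hu : ContDiff ℝ ∞ u) (t : ℝ) (i : Fin n) :
    dx i (fun x => u (t, x)) = fun x => pderiv (Sum.inr i) u (t, x) := by
  ext x
  have h1 : HasFDerivAt (fun x : Space n => ((t, x) : Spacetime n))
      (ContinuousLinearMap.inr ℝ ℝ (Space n)) x := by
    have := (hasFDerivAt_const t x).prodMk (hasFDerivAt_id (𝕜 := ℝ) x)
    exact this
  have h := (hu.differentiable (by simp) (t, x)).hasFDerivAt.comp x h1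
  have h2 : fderiv ℝ (fun x => u (t, x)) x =
      (fderiv ℝ u (t, x)).comp (ContinuousLinearMap.inr ℝ ℝ (Space n)) := h.fderiv
  simp [dx, pderiv, coordVec, h2]

theorem hasDerivAt_slice {u : Spacetime n → ℝ} {t : ℝ} {x : Space n}
    (hu : DifferentiableAt ℝ u (t, x)) :
    HasDerivAt (fun t => u (t, x)) (pderiv (Sum.inl ()) u (t, x)) t := by
  have h1 : HasDerivAt (fun t : ℝ => ((t, x) : Spacetime n)) (1, 0) t :=
    (hasDerivAt_id t).prodMk (hasDerivAt_const t x)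
  exact hu.hasFDerivAt.comp_hasDerivAt t h1

/-- Smooth functions that solve
`∂ₜ²u + 2κ ∂ₜu + ν² u - e^{-2t} Δu = 0` for times `t ≥ t₀`. -/
structure IsSolution (κ ν t₀ : ℝ) (u : Spacetime n → ℝ) : Prop where
  smooth : ContDiff ℝ ∞ u
  eq : ∀ t, t₀ ≤ t → ∀ x, pderiv (Sum.inl ()) (pderiv (Sum.inl ()) u) (t, x) +
    2 * κ * pderiv (Sum.inl ()) u (t, x) + ν ^ 2 * u (t, x) -
      Real.exp (-2 * t) * ∑ i, pderiv (Sum.inr i) (pderiv (Sum.inr i) u) (t, x) = 0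

theorem dx_linear_combination {ι : Type*} [Fintype ι] {A B U : Space n → ℝ}
    {L : ι → Space n → ℝ} (hA : ContDiff ℝ ∞ A) (hB : ContDiff ℝ ∞ B) (hU : ContDiff ℝ ∞ U)
    (hL : ∀ j, ContDiff ℝ ∞ (L j)) (a b c : ℝ) (i : Fin n) (x : Space n) :
    dx i (fun x => A x + a * B x + b * U x - c * ∑ j, L j x) x =
      dx i A x + a * dx i B x + b * dx i U x - c * ∑ j, dx i (L j) x := by
  have h1 := (hA.differentiable (by simp) x).hasFDerivAt
  have h2 := (hB.differentiable (by simp) x).hasFDerivAt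
  have h3 := (hU.differentiable (by simp) x).hasFDerivAt
  have h4 := HasFDerivAt.fun_sum fun j (_ : j ∈ Finset.univ) =>
    ((hL j).differentiable (by simp) x).hasFDerivAt
  have h := ((h1.add (h2.const_mul a)).add (h3.const_mul b)).sub (h4.const_mul c)
  have h' : fderiv ℝ (fun x => A x + a * B x + b * U x - c * ∑ j, L j x) x = _ := h.fderiv
  simp only [dx]
  rw [h']
  simp

/-- The coefficients do not depend on `x`. Only a fixed time slice is differentiated, so the
argument also works at `t = t₀`, where the equation is known on one side only. -/
theorem IsSolution.pderiv {κ ν t₀ : ℝ} {u : Spacetime n → ℝ} (hu : IsSolution κ ν t₀ u)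
    (i : Fin n) : IsSolution κ ν t₀ (pderiv (Sum.inr i) u) := by
  have hs := hu.smooth
  have h1 := contDiff_pderiv hs
  have h2 := fun μ ν => contDiff_pderiv (h1 μ) ν
  refine ⟨h1 _, fun t ht x => ?_⟩
  have h := dx_linear_combination (contDiff_slice (h2 (Sum.inl ()) (Sum.inl ())) t)
    (contDiff_slice (h1 (Sum.inl ())) t) (contDiff_slice hs t)
    (fun j : Fin n => contDiff_slice (h2 (Sum.inr j) (Sum.inr j)) t)
    (2 * κ) (ν ^ 2) (Real.exp (-2 * t)) i x
  have h0 : (fun x => DeSitter.pderiv (Sum.inl ()) (DeSitter.pderiv (Sum.inl ()) u) (t, x) +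
    2 * κ * DeSitter.pderiv (Sum.inl ()) u (t, x) + ν ^ 2 * u (t, x) -
      Real.exp (-2 * t) *
        ∑ i, DeSitter.pderiv (Sum.inr i) (DeSitter.pderiv (Sum.inr i) u) (t, x)) =
      fun _ => 0 := funext fun x => hu.eq t ht x
  rw [h0] at h
  simp only [dx_slice (h2 _ _), dx_slice (h1 _), dx_slice hs] at h
  have hc : ∀ μ, DeSitter.pderiv (Sum.inr i) (DeSitter.pderiv μ (DeSitter.pderiv μ u)) =
      DeSitter.pderiv μ (DeSitter.pderiv μ (DeSitter.pderiv (Sum.inr i) u)) := fun μ => by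
    rw [pderiv_comm (h1 μ), pderiv_comm hs (Sum.inr i) μ]
  simp only [hc, pderiv_comm hs (Sum.inr i) (Sum.inl ())] at h
  rw [← h]
  simp [dx]

/-! ### Localization to backward light cones -/

/-- Differentiation under the integral sign for spatially compactly supported functions. -/
theorem hasDerivAt_integral_slice {G : Spacetime n → ℝ} (hG : ContDiff ℝ ∞ G) {T R : ℝ}
    {x₀ : Space n} (hsupp : ∀ t, T ≤ t → ∀ x, x ∉ Metric.closedBall x₀ R → G (t, x) = 0)
    {t : ℝ} (ht : T < t) :
    HasDerivAt (fun t => ∫ x, G (t, x)) (∫ x, pderiv (Sum.inl ()) G (t, x)) t := by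
  have hG' := contDiff_pderiv hG (Sum.inl ())
  have hK : IsCompact (Icc T (t + 1) ×ˢ Metric.closedBall x₀ R) :=
    isCompact_Icc.prod (isCompact_closedBall _ _)
  obtain ⟨M, hM⟩ := hK.exists_bound_of_continuousOn hG'.continuous.continuousOn
  have hsupp' : ∀ t, T < t → ∀ x, x ∉ Metric.closedBall x₀ R →
      pderiv (Sum.inl ()) G (t, x) = 0 := fun t ht x hx => by
    have h1 := hasDerivAt_slice (hG.differentiable (by simp) (t, x))
    have h2 : HasDerivAt (fun t => G (t, x)) 0 t := by
      refine (hasDerivAt_const t (0 : ℝ)).congr_of_eventuallyEq ?_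
      filter_upwards [Ioi_mem_nhds ht] with s hs using hsupp s (le_of_lt hs) x hx
    exact h1.unique h2
  refine (hasDerivAt_integral_of_dominated_loc_of_deriv_le
    (F' := fun t x => pderiv (Sum.inl ()) G (t, x)) (s := Ioo T (t + 1))
    (bound := (Metric.closedBall x₀ R).indicator fun _ => M)
    (Ioo_mem_nhds ht (by linarith)) ?_ ?_ ?_ ?_ ?_ ?_).2
  · exact Filter.Eventually.of_forall fun s =>
      (contDiff_slice hG s).continuous.aestronglyMeasurable
  · exact (contDiff_slice hG t).continuous.integrable_of_hasCompactSupport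
      (HasCompactSupport.intro (isCompact_closedBall x₀ R) fun x hx => hsupp t ht.le x hx)
  · exact (contDiff_slice hG' t).continuous.aestronglyMeasurable
  · refine Filter.Eventually.of_forall fun x s hs => ?_
    by_cases hx : x ∈ Metric.closedBall x₀ R
    · rw [indicator_of_mem hx]
      exact hM (s, x) ⟨⟨hs.1.le, hs.2.le⟩, hx⟩
    · rw [indicator_of_notMem hx, hsupp' s hs.1 x hx, norm_zero]
  · rw [integrable_indicator_iff Metric.isClosed_closedBall.measurableSet]
    exact integrableOn_const (isCompact_closedBall x₀ R).measure_lt_top.ne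
  · exact Filter.Eventually.of_forall fun x s _ =>
      hasDerivAt_slice (hG.differentiable (by simp) (s, x))

/-- A smooth cutoff adapted to the backward light cones ending near `x₀`: it is
supported in a fixed ball, equals `1` on the unit ball around `x₀`, and decreases in time so fast
that the energy flux through its gradient is absorbed. -/
structure IsConeWeight (t₀ R : ℝ) (x₀ : Space n) (ζ : Spacetime n → ℝ) : Prop where
  smooth : ContDiff ℝ ∞ ζ
  nonneg : ∀ p, 0 ≤ ζ p
  le_one : ∀ p, ζ p ≤ 1
  eq_one : ∀ t, ∀ x ∈ Metric.closedBall x₀ 1, ζ (t, x) = 1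
  supp : ∀ t, t₀ - 1 ≤ t → ∀ x, x ∉ Metric.closedBall x₀ R → ζ (t, x) = 0
  deriv_nonpos : ∀ p, pderiv (Sum.inl ()) ζ p ≤ 0
  flux : ∀ t, t₀ ≤ t → ∀ x, ∀ (a : ℝ) (b : Fin n → ℝ),
    pderiv (Sum.inl ()) ζ (t, x) * (a ^ 2 + Real.exp (-2 * t) * ∑ i, b i ^ 2) ≤
      2 * Real.exp (-2 * t) * ∑ i, pderiv (Sum.inr i) ζ (t, x) * a * b i

theorem exists_isConeWeight (t₀ : ℝ) :
    ∃ R, ∀ x₀ : Space n, ∃ ζ, IsConeWeight t₀ R x₀ ζ := by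
  set q := Real.exp (-(t₀ - 1)) with hq
  have hq0 : 0 < q := Real.exp_pos _
  -- The weight will be a cutoff of `‖x - x₀‖² - c e^{-t}`, vanishing where this exceeds `2`. This
  -- `c` gives `2 + c q ≤ (c/2)²`, so the support has radius at most `c/2`; there the level sets
  -- move inwards at speed `c e^{-t} / (2‖x - x₀‖) ≥ e^{-t}`, the speed of light.
  set c : ℝ := 4 * (q + 1) with hc
  have hc0 : 0 < c := by positivity
  have hcone : ∀ t, t₀ - 1 ≤ t → ∀ r : ℝ, r - c * Real.exp (-t) ≤ 2 → r ≤ (c / 2) ^ 2 := by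
    intro t ht r hr
    have : Real.exp (-t) ≤ q := Real.exp_le_exp.2 (by linarith)
    have : c * Real.exp (-t) ≤ c * q := by gcongr
    nlinarith
  refine ⟨c / 2, fun x₀ => ?_⟩
  set h : ℝ → ℝ := fun σ => Real.smoothTransition (2 - σ) with hh
  have hhs : ContDiff ℝ ∞ h := Real.smoothTransition.contDiff.comp (contDiff_const.sub contDiff_id)
  have hanti : Antitone h := fun a b hab => Real.smoothTransition.monotone (by linarith)
  have hd : ∀ σ, deriv h σ ≤ 0 := fun σ => hanti.deriv_nonpos
  have hz : ∀ σ, 2 < σ → deriv h σ = 0 := fun σ hσ => by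
    have : h =ᶠ[nhds σ] fun _ => 0 := by
      filter_upwards [Ioi_mem_nhds hσ] with s hs
      exact Real.smoothTransition.zero_of_nonpos (by linarith [mem_Ioi.1 hs])
    rw [this.deriv_eq]
    simp
  set S : Spacetime n → ℝ := fun p => ‖p.2 - x₀‖ ^ 2 - c * Real.exp (-p.1) with hS
  have hSs : ContDiff ℝ ∞ S := by
    have : ContDiff ℝ ∞ fun p : Spacetime n => ‖p.2 - x₀‖ ^ 2 :=
      (contDiff_snd.sub contDiff_const).norm_sq ℝ
    exact this.sub (contDiff_const.mul (Real.contDiff_exp.comp contDiff_fst.neg))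
  have hchain : ∀ μ p, pderiv μ (h ∘ S) p = deriv h (S p) * pderiv μ S p := fun μ p => by
    have h1 := (hhs.differentiable (by simp) (S p)).hasDerivAt
    have h2 := (hSs.differentiable (by simp) p).hasFDerivAt
    have := (h1.comp_hasFDerivAt p h2).fderiv
    simp only [pderiv]
    rw [this]
    simp
  have hSt : ∀ p, pderiv (Sum.inl ()) S p = c * Real.exp (-p.1) := fun p => by
    have h1 := hasDerivAt_slice (hSs.differentiable (by simp) (p.1, p.2))
    have h2 : HasDerivAt (fun t => S (t, p.2)) (-(c * (Real.exp (-p.1) * -1))) p.1 := by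
      have := ((hasDerivAt_id p.1).neg.exp.const_mul c).const_sub (‖p.2 - x₀‖ ^ 2)
      simpa [hS] using this
    rw [h1.unique h2]
    ring
  have hSx : ∀ i p, pderiv (Sum.inr i) S p = 2 * (p.2 i - x₀ i) := fun i p => by
    have h1 : dx i (fun x => S (p.1, x)) p.2 = pderiv (Sum.inr i) S p :=
      congrFun (dx_slice hSs p.1 i) p.2
    rw [← h1]
    have h2 : HasFDerivAt (fun x : Space n => x - x₀) (ContinuousLinearMap.id ℝ (Space n)) p.2 :=
      (hasFDerivAt_id p.2).sub_const x₀
    have h3 := (h2.norm_sq).sub_const (c * Real.exp (-p.1))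
    have h4 : fderiv ℝ (fun x => S (p.1, x)) p.2 = _ := h3.fderiv
    rw [dx, h4]
    simp [EuclideanSpace.inner_single_right]
  refine ⟨h ∘ S, hhs.comp hSs, fun p => Real.smoothTransition.nonneg _,
    fun p => Real.smoothTransition.le_one _, fun t x hx => ?_, fun t ht x hx => ?_,
    fun p => ?_, fun t ht x a b => ?_⟩
  · refine Real.smoothTransition.one_of_one_le ?_
    have h1 : ‖x - x₀‖ ≤ 1 := by simpa [dist_eq_norm] using hx
    have h2 : 0 < c * Real.exp (-t) := by positivity
    have h3 : ‖x - x₀‖ ^ 2 ≤ 1 := pow_le_one₀ (norm_nonneg _) h1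
    simp only [hS]
    linarith
  · refine Real.smoothTransition.zero_of_nonpos ?_
    by_contra hcon
    push Not at hcon
    have h1 := hcone t ht (‖x - x₀‖ ^ 2) (by simp only [hS] at hcon; linarith)
    apply hx
    rw [Metric.mem_closedBall, dist_eq_norm]
    exact le_of_sq_le_sq h1 (by positivity)
  · rw [hchain, hSt]
    exact mul_nonpos_of_nonpos_of_nonneg (hd _) (by positivity)
  · simp only [hchain, hSt, hSx]
    set σ := S (t, x)
    set E := Real.exp (-t) with hE
    have hE0 : 0 < E := Real.exp_pos _
    have hE2 : Real.exp (-2 * t) = E ^ 2 := by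
      rw [hE, ← Real.exp_nat_mul]
      congr 1
      push_cast
      ring
    rw [hE2]
    by_cases hσ : 2 < σ
    · simp [hz σ hσ]
    have hr := hcone t (by linarith) (‖x - x₀‖ ^ 2) (not_lt.1 hσ)
    set B := ∑ i, b i ^ 2 with hB
    set Y := ∑ i, (x i - x₀ i) * b i with hY
    have hCS : Y ^ 2 ≤ (c / 2) ^ 2 * B := by
      refine (Finset.sum_mul_sq_le_sq_mul_sq _ _ _).trans ?_
      have : ∑ i, (x i - x₀ i) ^ 2 = ‖x - x₀‖ ^ 2 := by
        rw [EuclideanSpace.norm_sq_eq]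
        simp
      rw [this]
      exact mul_le_mul_of_nonneg_right hr (Finset.sum_nonneg fun i _ => sq_nonneg _)
    have hsum : ∑ i, deriv h σ * (2 * (x i - x₀ i)) * a * b i = deriv h σ * (2 * a * Y) := by
      rw [hY, Finset.mul_sum, Finset.mul_sum]
      refine Finset.sum_congr rfl fun i _ => ?_
      ring
    rw [hsum]
    -- The bound `|Y| ≤ (c/2) √B` makes this quadratic form in `a` nonnegative; multiplying by `c`
    -- completes the square.
    have hpos : 0 ≤ c * E * (a ^ 2 + E ^ 2 * B) - 4 * E ^ 2 * a * Y := by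
      have e : c * (c * E * (a ^ 2 + E ^ 2 * B) - 4 * E ^ 2 * a * Y) =
          E * ((c * a - 2 * E * Y) ^ 2 + 4 * E ^ 2 * ((c / 2) ^ 2 * B - Y ^ 2)) := by ring
      have : 0 ≤ c * (c * E * (a ^ 2 + E ^ 2 * B) - 4 * E ^ 2 * a * Y) := by
        rw [e]
        have := sub_nonneg.2 hCS
        positivity
      exact nonneg_of_mul_nonneg_right this hc0
    nlinarith [mul_nonneg (neg_nonneg.2 (hd σ)) hpos]

/-! ### Energy estimate -/

/-- The weighted energy density of a function on spacetime. -/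
def energyDensity (lam ν : ℝ) (u : Spacetime n → ℝ) (p : Spacetime n) : ℝ :=
  Real.exp (2 * lam * p.1) * (pderiv (Sum.inl ()) u p ^ 2 +
    Real.exp (-2 * p.1) * ∑ i, pderiv (Sum.inr i) u p ^ 2 + ν ^ 2 * u p ^ 2)

/-- The localized energy, summed over the spatial derivatives of order at most `s`. -/
def energySq (ζ : Spacetime n → ℝ) (lam ν : ℝ) : ℕ → (Spacetime n → ℝ) → ℝ → ℝ
  | 0, u, t => ∫ x, ζ (t, x) * energyDensity lam ν u (t, x)
  | s + 1, u, t => energySq ζ lam ν s u t + ∑ i, energySq ζ lam ν s (pderiv (Sum.inr i) u) t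

theorem energyDensity_nonneg (lam ν : ℝ) (u : Spacetime n → ℝ) (p : Spacetime n) :
    0 ≤ energyDensity lam ν u p := by
  have : 0 ≤ ∑ i, pderiv (Sum.inr i) u p ^ 2 := Finset.sum_nonneg fun i _ => sq_nonneg _
  unfold energyDensity
  positivity

theorem contDiff_energyDensity (lam ν : ℝ) {u : Spacetime n → ℝ} (hu : ContDiff ℝ ∞ u) :
    ContDiff ℝ ∞ (energyDensity lam ν u) := by
  have h1 := contDiff_pderiv hu
  unfold energyDensity
  refine (Real.contDiff_exp.comp (contDiff_const.mul contDiff_fst)).mul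
    ((((h1 _).pow 2).add ((Real.contDiff_exp.comp (contDiff_const.mul contDiff_fst)).mul
      (ContDiff.sum fun i _ => (h1 _).pow 2))).add (contDiff_const.mul (hu.pow 2)))

/-- Multiply the equation by `∂ₜu`: up to a spatial divergence, the time derivative of the weighted
density consists of terms `-2(2κ - λ)(∂ₜu)²` and `-2(1 - λ)e^{-2t}|∇u|²`, a mass term with factor
`λν² = 0`, and derivatives of `ζ`, whose sign is controlled by `flux` and `deriv_nonpos`. -/
theorem pderiv_energy_le {κ ν lam t₀ R : ℝ} {x₀ : Space n} {ζ u : Spacetime n → ℝ}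
    (hζ : IsConeWeight t₀ R x₀ ζ) (hu : IsSolution κ ν t₀ u) (h1 : lam ≤ 2 * κ) (h2 : lam ≤ 1)
    (h3 : lam * ν = 0) {t : ℝ} (ht : t₀ ≤ t) (x : Space n) :
    pderiv (Sum.inl ()) (fun p => ζ p * energyDensity lam ν u p) (t, x) ≤
      2 * Real.exp (2 * lam * t) * Real.exp (-2 * t) * ∑ i, pderiv (Sum.inr i)
        (fun p => ζ p * (pderiv (Sum.inl ()) u p * pderiv (Sum.inr i) u p)) (t, x) := by
  have hs := hu.smooth
  have hs1 := contDiff_pderiv hs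
  have hdt : ∀ {v : Spacetime n → ℝ}, ContDiff ℝ ∞ v →
      HasDerivAt (fun t => v (t, x)) (pderiv (Sum.inl ()) v (t, x)) t := fun hv =>
    hasDerivAt_slice (hv.differentiable (by simp) (t, x))
  have hX : HasDerivAt (fun t : ℝ => Real.exp (2 * lam * t))
      (Real.exp (2 * lam * t) * (2 * lam)) t := by
    simpa using ((hasDerivAt_id t).const_mul (2 * lam)).exp
  have hY : HasDerivAt (fun t : ℝ => Real.exp (-2 * t)) (Real.exp (-2 * t) * (-2)) t := by
    simpa using ((hasDerivAt_id t).const_mul (-2 : ℝ)).exp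
  have hE := (hdt hζ.smooth).mul (hX.mul ((((hdt (hs1 (Sum.inl ()))).pow 2).add
    (hY.mul (HasDerivAt.fun_sum fun i (_ : i ∈ Finset.univ) =>
      (hdt (hs1 (Sum.inr i))).pow 2))).add (((hdt hs).pow 2).const_mul (ν ^ 2))))
  have hG := hdt (hζ.smooth.mul (contDiff_energyDensity lam ν hs))
  have hval := hG.unique hE
  have hdx : ∀ i, pderiv (Sum.inr i)
      (fun p => ζ p * (pderiv (Sum.inl ()) u p * pderiv (Sum.inr i) u p)) (t, x) =
      pderiv (Sum.inr i) ζ (t, x) * pderiv (Sum.inl ()) u (t, x) * pderiv (Sum.inr i) u (t, x) +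
      ζ (t, x) * (pderiv (Sum.inl ()) u (t, x) *
          pderiv (Sum.inr i) (pderiv (Sum.inr i) u) (t, x) +
        pderiv (Sum.inl ()) (pderiv (Sum.inr i) u) (t, x) * pderiv (Sum.inr i) u (t, x)) := by
    intro i
    have d1 := (hζ.smooth.differentiable (by simp) (t, x)).hasFDerivAt
    have d2 := ((hs1 (Sum.inl ())).differentiable (by simp) (t, x)).hasFDerivAt
    have d3 := ((hs1 (Sum.inr i)).differentiable (by simp) (t, x)).hasFDerivAt
    have d := (d1.mul (d2.mul d3)).fderiv
    rw [pderiv_comm hs (Sum.inl ()) (Sum.inr i)]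
    have d' : fderiv ℝ (fun p => ζ p * (pderiv (Sum.inl ()) u p * pderiv (Sum.inr i) u p))
      (t, x) = _ := d
    conv_lhs => rw [pderiv, d']
    simp only [add_apply, _root_.smul_apply, smul_eq_mul, Pi.mul_apply, pderiv]
    ring
  simp only [hdx]
  refine hval.le.trans ?_
  have heq := hu.eq t ht x
  have hflux := hζ.flux t ht x (pderiv (Sum.inl ()) u (t, x))
    fun i => pderiv (Sum.inr i) u (t, x)
  have hζ0 := hζ.nonneg (t, x)
  have hζt := hζ.deriv_nonpos (t, x)
  simp only [Pi.add_apply, Pi.mul_apply, Pi.pow_apply, Finset.sum_add_distrib, mul_add,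
    ← Finset.mul_sum] at hflux ⊢
  set X := Real.exp (2 * lam * t)
  set Y := Real.exp (-2 * t)
  have hX0 : 0 < X := Real.exp_pos _
  have hY0 : 0 < Y := Real.exp_pos _
  set a := pderiv (Sum.inl ()) u (t, x)
  set b := pderiv (Sum.inl ()) (pderiv (Sum.inl ()) u) (t, x)
  set L := ∑ i, pderiv (Sum.inr i) (pderiv (Sum.inr i) u) (t, x)
  set B := ∑ i, pderiv (Sum.inr i) u (t, x) ^ 2 with hB
  set M := ∑ i, pderiv (Sum.inl ()) (pderiv (Sum.inr i) u) (t, x) * pderiv (Sum.inr i) u (t, x)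
    with hM
  set N := ∑ i, pderiv (Sum.inr i) ζ (t, x) * a * pderiv (Sum.inr i) u (t, x)
  set z := ζ (t, x)
  set z' := pderiv (Sum.inl ()) ζ (t, x)
  set w := u (t, x)
  have hB0 : 0 ≤ B := Finset.sum_nonneg fun i _ => sq_nonneg _
  have hsum : ∑ i, ((2 : ℕ) : ℝ) * pderiv (Sum.inr i) u (t, x) ^ (2 - 1) *
      pderiv (Sum.inl ()) (pderiv (Sum.inr i) u) (t, x) = 2 * M := by
    rw [hM, Finset.mul_sum]
    refine Finset.sum_congr rfl fun i _ => ?_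
    norm_num
    ring
  rw [hsum]
  have hb : b = Y * L - 2 * κ * a - ν ^ 2 * w := by linarith
  have h4 : lam * ν ^ 2 = 0 := by rw [sq, ← mul_assoc, h3, zero_mul]
  have hfin : 0 ≤ X * ((2 * Y * N - (z' * a ^ 2 + z' * (Y * B))) + (-z') * (ν ^ 2 * w ^ 2) +
      z * (2 * (2 * κ - lam) * a ^ 2 + 2 * (1 - lam) * (Y * B))) := by
    have e1 : 0 ≤ 2 * Y * N - (z' * a ^ 2 + z' * (Y * B)) := sub_nonneg.2 hflux
    have e2 : 0 ≤ -z' := neg_nonneg.2 hζt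
    have e3 : 0 ≤ 2 * κ - lam := sub_nonneg.2 h1
    have e4 : 0 ≤ 1 - lam := sub_nonneg.2 h2
    positivity
  rw [hb]
  norm_num
  linear_combination hfin + 2 * z * X * w ^ 2 * h4

theorem energySq_zero_hasDerivAt {t₀ R lam ν : ℝ} {x₀ : Space n} {ζ u : Spacetime n → ℝ}
    (hζ : IsConeWeight t₀ R x₀ ζ) (hu : ContDiff ℝ ∞ u) {t : ℝ} (ht : t₀ ≤ t) :
    HasDerivAt (energySq ζ lam ν 0 u)
      (∫ x, pderiv (Sum.inl ()) (fun p => ζ p * energyDensity lam ν u p) (t, x)) t :=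
  -- The margin `t₀ - 1` in `IsConeWeight.supp` gives a two-sided derivative at `t₀` itself.
  hasDerivAt_integral_slice (hζ.smooth.mul (contDiff_energyDensity lam ν hu)) (T := t₀ - 1)
    (R := R) (x₀ := x₀) (fun t ht x hx => by simp [hζ.supp t ht x hx]) (by linarith)

theorem hasCompactSupport_weight_mul {t₀ R : ℝ} {x₀ : Space n} {ζ : Spacetime n → ℝ}
    (hζ : IsConeWeight t₀ R x₀ ζ) {t : ℝ} (ht : t₀ ≤ t) (f : Space n → ℝ) :
    HasCompactSupport fun x => ζ (t, x) * f x :=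
  HasCompactSupport.intro (isCompact_closedBall x₀ R) fun x hx => by
    simp [hζ.supp t (by linarith) x hx]

theorem deriv_energy_nonpos {κ ν lam t₀ R : ℝ} {x₀ : Space n} {ζ u : Spacetime n → ℝ}
    (hζ : IsConeWeight t₀ R x₀ ζ) (hu : IsSolution κ ν t₀ u) (h1 : lam ≤ 2 * κ) (h2 : lam ≤ 1)
    (h3 : lam * ν = 0) {t : ℝ} (ht : t₀ ≤ t) :
    ∫ x, pderiv (Sum.inl ()) (fun p => ζ p * energyDensity lam ν u p) (t, x) ≤ 0 := by
  have hs := hu.smooth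
  have hs1 := contDiff_pderiv hs
  have hH : ∀ i : Fin n, ContDiff ℝ ∞
      fun p => ζ p * (pderiv (Sum.inl ()) u p * pderiv (Sum.inr i) u p) := fun i =>
    hζ.smooth.mul ((hs1 _).mul (hs1 _))
  have hc : ∀ i : Fin n, HasCompactSupport fun x =>
      ζ (t, x) * (pderiv (Sum.inl ()) u (t, x) * pderiv (Sum.inr i) u (t, x)) := fun i =>
    hasCompactSupport_weight_mul hζ ht _
  have hint : ∀ i : Fin n, Integrable fun x => pderiv (Sum.inr i)
      (fun p => ζ p * (pderiv (Sum.inl ()) u p * pderiv (Sum.inr i) u p)) (t, x) := fun i => by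
    rw [← dx_slice (hH i)]
    exact (contDiff_dx (contDiff_slice (hH i) t) i).continuous.integrable_of_hasCompactSupport
      (hasCompactSupport_dx (hc i) i)
  have hzero : ∀ i : Fin n, ∫ x, pderiv (Sum.inr i)
      (fun p => ζ p * (pderiv (Sum.inl ()) u p * pderiv (Sum.inr i) u p)) (t, x) = 0 := fun i => by
    rw [← dx_slice (hH i)]
    exact integral_dx_eq_zero (contDiff_slice (hH i) t) (hc i) i
  have hR : Integrable fun x => 2 * Real.exp (2 * lam * t) * Real.exp (-2 * t) *
      ∑ i, pderiv (Sum.inr i)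
        (fun p => ζ p * (pderiv (Sum.inl ()) u p * pderiv (Sum.inr i) u p)) (t, x) :=
    (integrable_finsetSum _ fun i _ => hint i).const_mul _
  by_cases hL : Integrable fun x =>
      pderiv (Sum.inl ()) (fun p => ζ p * energyDensity lam ν u p) (t, x)
  · refine (integral_mono hL hR fun x => pderiv_energy_le hζ hu h1 h2 h3 ht x).trans ?_
    rw [integral_const_mul, integral_finsetSum _ fun i _ => hint i]
    simp [hzero]
  -- A non-integrable integrand has integral `0` by convention, so the inequality holds without
  -- checking integrability.
  · rw [integral_undef hL]

theorem energySq_antitone {κ ν lam t₀ R : ℝ} {x₀ : Space n} {ζ u : Spacetime n → ℝ}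
    (hζ : IsConeWeight t₀ R x₀ ζ) (hu : IsSolution κ ν t₀ u) (h1 : lam ≤ 2 * κ) (h2 : lam ≤ 1)
    (h3 : lam * ν = 0) (s : ℕ) : AntitoneOn (energySq ζ lam ν s u) (Ici t₀) := by
  induction s generalizing u with
  | zero =>
    have hd := fun {t : ℝ} (ht : t₀ ≤ t) =>
      energySq_zero_hasDerivAt (lam := lam) (ν := ν) hζ hu.smooth ht
    refine antitoneOn_of_deriv_nonpos (convex_Ici t₀)
      (fun t ht => (hd ht).continuousAt.continuousWithinAt)
      (fun t ht => (hd (interior_subset ht)).differentiableAt.differentiableWithinAt)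
      fun t ht => ?_
    rw [(hd (interior_subset ht)).deriv]
    exact deriv_energy_nonpos hζ hu h1 h2 h3 (interior_subset ht)
  | succ s ih =>
    intro a ha b hb hab
    simp only [energySq]
    exact add_le_add (ih hu ha hb hab) (Finset.sum_le_sum fun i _ => ih (hu.pderiv i) ha hb hab)

/-- On the unit ball `ζ = 1`, and the gradient term is discarded. The power of `e^{-2t}` multiplying
it is why no decay of `∇u` is sought. -/
theorem sobSq_le_energySq {t₀ R lam ν : ℝ} {x₀ : Space n} {ζ u : Spacetime n → ℝ}
    (hζ : IsConeWeight t₀ R x₀ ζ) (hu : ContDiff ℝ ∞ u) {t : ℝ} (ht : t₀ ≤ t) (s : ℕ) :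
    Real.exp (2 * lam * t) *
        (sobSq (Metric.closedBall x₀ 1) s (fun x => pderiv (Sum.inl ()) u (t, x)) +
      ν ^ 2 * sobSq (Metric.closedBall x₀ 1) s (fun x => u (t, x))) ≤
      energySq ζ lam ν s u t := by
  induction s generalizing u with
  | zero =>
    have hs1 := contDiff_pderiv hu
    have hi : ∀ {f : Spacetime n → ℝ}, ContDiff ℝ ∞ f →
        IntegrableOn (fun x => f (t, x) ^ 2) (Metric.closedBall x₀ 1) := fun hf =>
      ((contDiff_slice hf t).continuous.pow 2).continuousOn.integrableOn_compact
        (isCompact_closedBall _ _)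
    simp only [sobSq, energySq]
    rw [← integral_const_mul, ← integral_add (hi (hs1 _)) ((hi hu).const_mul _),
      ← integral_const_mul, ← integral_indicator Metric.isClosed_closedBall.measurableSet]
    refine integral_mono ?_ ?_ fun x => ?_
    · rw [integrable_indicator_iff Metric.isClosed_closedBall.measurableSet]
      exact ((hi (hs1 _)).add ((hi hu).const_mul _)).const_mul _
    · exact ((contDiff_slice (hζ.smooth.mul (contDiff_energyDensity lam ν hu))
        t).continuous).integrable_of_hasCompactSupport
        (hasCompactSupport_weight_mul hζ ht fun x => energyDensity lam ν u (t, x))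
    · by_cases hx : x ∈ Metric.closedBall x₀ 1
      · have hB : 0 ≤ ∑ i, pderiv (Sum.inr i) u (t, x) ^ 2 :=
          Finset.sum_nonneg fun i _ => sq_nonneg _
        have hY := Real.exp_pos (-2 * t)
        simp only [indicator_of_mem hx, hζ.eq_one t x hx, one_mul, energyDensity]
        gcongr
        exact le_add_of_nonneg_right (by positivity)
      · simp only [indicator_of_notMem hx]
        exact mul_nonneg (hζ.nonneg _) (energyDensity_nonneg _ _ _ _)
  | succ s ih =>
    have hs1 := contDiff_pderiv hu
    simp only [sobSq, energySq, dx_slice hu, dx_slice (hs1 _)]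
    have h := Finset.sum_le_sum fun i (_ : i ∈ Finset.univ) => ih (hs1 (Sum.inr i))
    simp only [Finset.sum_add_distrib, ← Finset.mul_sum,
      pderiv_comm hu (Sum.inl ()) (Sum.inr _)] at h
    linarith [ih hu]

/-- Since `ζ ≤ 1`, the global initial energy bounds every localized one. This is the only use of
square integrability in the energy argument, and it makes the final constant independent of the
centre. -/
theorem exists_energySq_le (lam ν t₀ : ℝ) {u : Spacetime n → ℝ} (hu : ContDiff ℝ ∞ u) (s : ℕ)
    (h0 : MemHs s fun x => u (t₀, x)) (h1 : MemHs s fun x => pderiv (Sum.inl ()) u (t₀, x))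
    (h2 : ∀ i, MemHs s fun x => pderiv (Sum.inr i) u (t₀, x)) :
    ∃ C, ∀ R x₀ ζ, IsConeWeight t₀ R x₀ ζ → energySq ζ lam ν s u t₀ ≤ C := by
  induction s generalizing u with
  | zero =>
    refine ⟨∫ x, energyDensity lam ν u (t₀, x), fun R x₀ ζ hζ => ?_⟩
    have hi : Integrable fun x => energyDensity lam ν u (t₀, x) := by
      simp only [energyDensity]
      exact (((MemLp.integrable_sq h1).add ((integrable_finsetSum _ fun i _ =>
        MemLp.integrable_sq (h2 i)).const_mul _)).add
        ((MemLp.integrable_sq h0).const_mul _)).const_mul _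
    refine integral_mono_of_nonneg (Filter.Eventually.of_forall fun x =>
      mul_nonneg (hζ.nonneg _) (energyDensity_nonneg _ _ _ _)) hi
      (Filter.Eventually.of_forall fun x => ?_)
    exact mul_le_of_le_one_left (energyDensity_nonneg _ _ _ _) (hζ.le_one _)
  | succ s ih =>
    have hs1 := contDiff_pderiv hu
    obtain ⟨C, hC⟩ := ih hu h0.1 h1.1 fun i => (h2 i).1
    choose D hD using fun i : Fin n => ih (hs1 (Sum.inr i)) (h2 i).1
      (by
        have := h1.2 i
        rwa [dx_slice (hs1 _), pderiv_comm hu] at this)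
      (fun j => by
        have := (h2 i).2 j
        rwa [dx_slice (hs1 _)] at this)
    exact ⟨C + ∑ i, D i, fun R x₀ ζ hζ =>
      add_le_add (hC R x₀ ζ hζ) (Finset.sum_le_sum fun i _ => hD i R x₀ ζ hζ)⟩

/-- Uniform decay of solutions with square integrable data. -/
theorem IsSolution.exists_bound {κ ν lam t₀ : ℝ} {u : Spacetime n → ℝ}
    (hu : IsSolution κ ν t₀ u) (hl1 : lam ≤ 2 * κ) (hl2 : lam ≤ 1) (hl3 : lam * ν = 0)
    {s : ℕ} (hs : (n : ℝ) < 2 * s)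
    (h0 : MemHs s fun x => u (t₀, x)) (h1 : MemHs s fun x => DeSitter.pderiv (Sum.inl ()) u (t₀, x))
    (h2 : ∀ i, MemHs s fun x => DeSitter.pderiv (Sum.inr i) u (t₀, x)) :
    ∃ C, 0 ≤ C ∧ ∀ t, t₀ ≤ t → ∀ x, |DeSitter.pderiv (Sum.inl ()) u (t, x)| ≤
      C * Real.exp (-lam * t) ∧ |ν| * |u (t, x)| ≤ C * Real.exp (-lam * t) := by
  obtain ⟨K, hK0, hK⟩ := exists_local_sobolev_const hs
  obtain ⟨E, hE⟩ := exists_energySq_le lam ν t₀ hu.smooth s h0 h1 h2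
  obtain ⟨R, hR⟩ := exists_isConeWeight (n := n) t₀
  have hexp : ∀ t : ℝ, Real.exp (2 * lam * t) * Real.exp (-lam * t) ^ 2 = 1 := fun t => by
    rw [← Real.exp_nat_mul, ← Real.exp_add]
    convert Real.exp_zero using 2
    push_cast
    ring
  refine ⟨Real.sqrt (K * E), Real.sqrt_nonneg _, fun t ht x => ?_⟩
  obtain ⟨ζ, hζ⟩ := hR x
  have hen := ((sobSq_le_energySq (lam := lam) (ν := ν) hζ hu.smooth ht s).trans
    (energySq_antitone hζ hu hl1 hl2 hl3 s self_mem_Ici ht ht)).trans (hE R x ζ hζ)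
  have hS1 := hK _ (contDiff_slice (contDiff_pderiv hu.smooth (Sum.inl ())) t) x
  have hS2 := hK _ (contDiff_slice hu.smooth t) x
  have hp1 := sobSq_nonneg (Metric.closedBall x 1) s
    (fun x => DeSitter.pderiv (Sum.inl ()) u (t, x))
  have hp2 := sobSq_nonneg (Metric.closedBall x 1) s (fun x => u (t, x))
  set P := sobSq (Metric.closedBall x 1) s (fun x => DeSitter.pderiv (Sum.inl ()) u (t, x))
  set Q := sobSq (Metric.closedBall x 1) s (fun x => u (t, x))
  set Z := Real.exp (-lam * t)
  have hZ : 0 < Z := Real.exp_pos _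
  have hX := Real.exp_pos (2 * lam * t)
  have hKE : K * (P + ν ^ 2 * Q) ≤ K * E * Z ^ 2 := by
    have := mul_le_mul_of_nonneg_left hen (mul_nonneg hK0 (sq_nonneg Z))
    linear_combination this - K * (P + ν ^ 2 * Q) * hexp t
  have hconv : ∀ y : ℝ, y ^ 2 ≤ K * E * Z ^ 2 → |y| ≤ Real.sqrt (K * E) * Z := fun y hy => by
    have := Real.abs_le_sqrt hy
    rwa [Real.sqrt_mul' _ (sq_nonneg Z), Real.sqrt_sq hZ.le] at this
  refine ⟨hconv _ ?_, ?_⟩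
  · have : 0 ≤ K * (ν ^ 2 * Q) := by positivity
    linarith
  · rw [← abs_mul]
    refine hconv _ ?_
    have : 0 ≤ K * P := by positivity
    have := mul_le_mul_of_nonneg_left hS2 (sq_nonneg ν)
    rw [mul_pow]
    linarith

/-! ### The de Sitter d'Alembertian and reduction to the rescaled equation -/

theorem pderiv_congr {f g : Spacetime n → ℝ} {p : Spacetime n} (h : f =ᶠ[nhds p] g)
    (μ : Coord n) : pderiv μ f =ᶠ[nhds p] pderiv μ g :=
  (h.fderiv (𝕜 := ℝ)).mono fun q hq => by simp only [pderiv, hq]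

/-- Locality of the operator lets `φ`, smooth only for `t > tStar`, be replaced by a globally smooth
extension. -/
theorem dAlembertian_congr (g : Spacetime n → Matrix (Coord n) (Coord n) ℝ)
    {φ ψ : Spacetime n → ℝ} {p : Spacetime n} (h : φ =ᶠ[nhds p] ψ) :
    dAlembertian g φ p = dAlembertian g ψ p := by
  unfold dAlembertian
  congr 1
  refine Finset.sum_congr rfl fun μ _ => ?_
  refine (pderiv_congr ?_ μ).self_of_nhds
  have := Filter.eventually_all.2 fun ν => pderiv_congr h ν
  filter_upwards [this] with q hq
  simp only [hq]

theorem pderiv_time_mul_inl {f : ℝ → ℝ} {f' : ℝ} {v : Spacetime n → ℝ} (hv : ContDiff ℝ ∞ v)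
    (hf : ContDiff ℝ ∞ f) {p : Spacetime n} (hf' : HasDerivAt f f' p.1) :
    pderiv (Sum.inl ()) (fun p => f p.1 * v p) p =
      f' * v p + f p.1 * pderiv (Sum.inl ()) v p := by
  have h1 := hasDerivAt_slice (t := p.1) (x := p.2)
    (((hf.comp contDiff_fst).mul hv).differentiable (by simp) (p.1, p.2))
  have h2 := hasDerivAt_slice (t := p.1) (x := p.2) (hv.differentiable (by simp) (p.1, p.2))
  exact h1.unique (hf'.mul h2)

theorem pderiv_time_mul_inr {f : ℝ → ℝ} {v : Spacetime n → ℝ} (hv : ContDiff ℝ ∞ v)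
    (hf : ContDiff ℝ ∞ f) (i : Fin n) (p : Spacetime n) :
    pderiv (Sum.inr i) (fun p => f p.1 * v p) p = f p.1 * pderiv (Sum.inr i) v p := by
  have h1 := congrFun (dx_slice ((hf.comp contDiff_fst).mul hv) p.1 i) p.2
  have h2 := congrFun (dx_slice hv p.1 i) p.2
  have h3 := congrFun (dx_const_smul (contDiff_slice hv p.1) (f p.1) i) p.2
  simp only [Pi.smul_apply, smul_eq_mul] at h3
  rw [h2] at h3
  exact h1.symm.trans h3

theorem deSitterMetric_sqrt_det (p : Spacetime n) :
    Real.sqrt (-(deSitterMetric n p).det) = Real.exp (n * p.1) := by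
  rw [deSitterMetric, Matrix.det_diagonal, Fintype.prod_sum_type]
  simp only [Sum.elim_inl, Sum.elim_inr, Finset.prod_const, Finset.card_univ, Fintype.card_fin,
    scaleFactor, Fintype.card_unit]
  rw [← Real.exp_nat_mul, ← Real.exp_nat_mul, pow_one, neg_mul, neg_neg, one_mul,
    ← Real.exp_half]
  congr 1
  push_cast
  ring

theorem deSitterMetric_inv (p : Spacetime n) :
    (deSitterMetric n p)⁻¹ =
      Matrix.diagonal (Sum.elim (fun _ => -1) (fun _ => Real.exp (-2 * p.1))) := by
  refine Matrix.inv_eq_right_inv ?_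
  rw [deSitterMetric, Matrix.diagonal_mul_diagonal, ← Matrix.diagonal_one]
  congr 1
  ext μ
  rcases μ with _ | i
  · simp
  · simp only [Sum.elim_inr, scaleFactor]
    rw [← Real.exp_nat_mul, ← Real.exp_add]
    convert Real.exp_zero using 2
    push_cast
    ring

/-- The friction term `n ∂ₜφ` comes from the time derivative of the volume factor `e^{nt}`. -/
theorem dAlembertian_deSitterMetric {φ : Spacetime n → ℝ} (hφ : ContDiff ℝ ∞ φ)
    (p : Spacetime n) :
    dAlembertian (deSitterMetric n) φ p =
      -pderiv (Sum.inl ()) (pderiv (Sum.inl ()) φ) p - n * pderiv (Sum.inl ()) φ p +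
        Real.exp (-2 * p.1) * ∑ i, pderiv (Sum.inr i) (pderiv (Sum.inr i) φ) p := by
  have h1 := contDiff_pderiv hφ
  unfold dAlembertian
  simp only [deSitterMetric_sqrt_det, deSitterMetric_inv, Matrix.diagonal_apply, ite_mul, zero_mul,
    Finset.sum_ite_eq, Finset.mem_univ, if_true, Fintype.sum_sum_type, Sum.elim_inl, Sum.elim_inr,
    Finset.univ_unique, Finset.sum_singleton]
  have hexp : ∀ c : ℝ, ContDiff ℝ ∞ fun t : ℝ => Real.exp (c * t) := fun c =>
    Real.contDiff_exp.comp (contDiff_const.mul contDiff_id)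
  have ht : pderiv (Sum.inl ()) (fun q => Real.exp (n * q.1) * (-1 * pderiv (Sum.inl ()) φ q)) p =
      -Real.exp (n * p.1) * (pderiv (Sum.inl ()) (pderiv (Sum.inl ()) φ) p +
        n * pderiv (Sum.inl ()) φ p) := by
    have hd : HasDerivAt (fun t : ℝ => -Real.exp (n * t)) (-(Real.exp (n * p.1) * n)) p.1 := by
      simpa using (((hasDerivAt_id p.1).const_mul (n : ℝ)).exp).fun_neg
    have := pderiv_time_mul_inl (h1 (Sum.inl ())) (hexp n).neg hd
    rw [show (fun q : Spacetime n => Real.exp (n * q.1) * (-1 * pderiv (Sum.inl ()) φ q)) =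
      fun q => -Real.exp (n * q.1) * pderiv (Sum.inl ()) φ q from funext fun q => by ring, this]
    ring
  have hx : ∀ i : Fin n, pderiv (Sum.inr i)
      (fun q => Real.exp (n * q.1) * (Real.exp (-2 * q.1) * pderiv (Sum.inr i) φ q)) p =
      Real.exp (n * p.1) * Real.exp (-2 * p.1) *
        pderiv (Sum.inr i) (pderiv (Sum.inr i) φ) p := fun i => by
    have := pderiv_time_mul_inr (h1 (Sum.inr i)) ((hexp n).mul (hexp (-2))) i p
    rw [← this]
    congr 1
    ext q
    ring
  have hz := Real.exp_ne_zero (n * p.1)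
  rw [show (default : Unit) = () from rfl, ht]
  simp only [hx, ← Finset.mul_sum]
  field_simp
  ring

/-- A function that is smooth on `(tStar, ∞) × ℝⁿ` agrees for times after some `β < t₀` with a
globally smooth function. -/
theorem exists_contDiff_extension {tStar t₀ : ℝ} (h : tStar < t₀) {φ : Spacetime n → ℝ}
    (hφ : ContDiffOn ℝ ∞ φ (Ioi tStar ×ˢ univ)) :
    ∃ Φ : Spacetime n → ℝ, ContDiff ℝ ∞ Φ ∧ ∃ β < t₀, ∀ t, β < t → ∀ x, Φ (t, x) = φ (t, x) := by
  set δ := (t₀ - tStar) / 3 with hδ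
  have hδ0 : 0 < δ := by rw [hδ]; linarith
  set χ : ℝ → ℝ := fun t => Real.smoothTransition ((t - (tStar + δ)) / δ) with hχ
  have hχs : ContDiff ℝ ∞ χ :=
    Real.smoothTransition.contDiff.comp ((contDiff_id.sub contDiff_const).div_const δ)
  refine ⟨fun p => χ p.1 * φ p, ?_, tStar + 2 * δ, by rw [hδ]; linarith, fun t ht x => ?_⟩
  · rw [contDiff_iff_contDiffAt]
    intro p
    by_cases hp : tStar < p.1
    · exact (hχs.comp contDiff_fst).contDiffAt.mul
        (hφ.contDiffAt ((isOpen_Ioi.prod isOpen_univ).mem_nhds ⟨hp, mem_univ _⟩))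
    · refine (contDiffAt_const (c := (0 : ℝ))).congr_of_eventuallyEq ?_
      have : {q : Spacetime n | q.1 < tStar + δ} ∈ nhds p :=
        (isOpen_lt continuous_fst continuous_const).mem_nhds
          (show p.1 < tStar + δ by linarith)
      filter_upwards [this] with q hq
      have : χ q.1 = 0 := Real.smoothTransition.zero_of_nonpos
        (div_nonpos_of_nonpos_of_nonneg (by linarith [show q.1 < tStar + δ from hq]) hδ0.le)
      simp [this]
  · have : χ t = 1 := Real.smoothTransition.one_of_one_le (by
      rw [le_div_iff₀ hδ0]; linarith)
    simp [this]

/-- The rescaling `e^{ct} φ` of a solution of the Klein–Gordon equation. -/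
theorem isSolution_exp_mul {Φ : Spacetime n → ℝ} (hΦ : ContDiff ℝ ∞ Φ) {m t₀ c κ ν : ℝ}
    (hKG : ∀ t, t₀ ≤ t → ∀ x, dAlembertian (deSitterMetric n) Φ (t, x) - m ^ 2 * Φ (t, x) = 0)
    (hc : 2 * c + 2 * κ = n) (hm : c ^ 2 + 2 * κ * c + ν ^ 2 = m ^ 2) :
    IsSolution κ ν t₀ fun p => Real.exp (c * p.1) * Φ p := by
  have h1 := contDiff_pderiv hΦ
  have hexp : ContDiff ℝ ∞ fun t : ℝ => Real.exp (c * t) :=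
    Real.contDiff_exp.comp (contDiff_const.mul contDiff_id)
  have hd : ∀ t : ℝ, HasDerivAt (fun t : ℝ => Real.exp (c * t)) (Real.exp (c * t) * c) t :=
    fun t => by simpa using ((hasDerivAt_id t).const_mul c).exp
  have hl : ∀ {v : Spacetime n → ℝ}, ContDiff ℝ ∞ v →
      pderiv (Sum.inl ()) (fun p => Real.exp (c * p.1) * v p) =
        fun p => Real.exp (c * p.1) * (c * v p + pderiv (Sum.inl ()) v p) := fun hv => by
    ext p
    rw [pderiv_time_mul_inl hv hexp (hd p.1)]
    ring
  have hr : ∀ {v : Spacetime n → ℝ}, ContDiff ℝ ∞ v → ∀ i,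
      pderiv (Sum.inr i) (fun p => Real.exp (c * p.1) * v p) =
        fun p => Real.exp (c * p.1) * pderiv (Sum.inr i) v p := fun hv i => by
    ext p
    rw [pderiv_time_mul_inr hv hexp]
  refine ⟨(hexp.comp contDiff_fst).mul hΦ, fun t ht x => ?_⟩
  have h2 : pderiv (Sum.inl ()) (fun p => c * Φ p + pderiv (Sum.inl ()) Φ p) =
      fun p => c * pderiv (Sum.inl ()) Φ p + pderiv (Sum.inl ()) (pderiv (Sum.inl ()) Φ) p := by
    ext p
    have e1 := hasDerivAt_slice (t := p.1) (x := p.2) (hΦ.differentiable (by simp) (p.1, p.2))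
    have e2 := hasDerivAt_slice (t := p.1) (x := p.2)
      ((h1 (Sum.inl ())).differentiable (by simp) (p.1, p.2))
    have e3 := hasDerivAt_slice (t := p.1) (x := p.2)
      (((contDiff_const (c := c)).mul hΦ).add (h1 (Sum.inl ())) |>.differentiable (by simp)
        (p.1, p.2))
    exact e3.unique ((e1.const_mul c).add e2)
  rw [hl hΦ, hl ((contDiff_const.mul hΦ).add (h1 _)), h2]
  simp only [hr hΦ, hr (h1 _), ← Finset.mul_sum]
  have h := hKG t ht x
  rw [dAlembertian_deSitterMetric hΦ] at h
  simp only at h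
  linear_combination (-Real.exp (c * t)) * h + Real.exp (c * t) * pderiv (Sum.inl ()) Φ (t, x) * hc
    + Real.exp (c * t) * Φ (t, x) * hm

/-! ### Integration in time and bounds for the rescaled field -/

theorem IsSolution.le_add_mul {κ ν t₀ C : ℝ} {u : Spacetime n → ℝ} (hu : IsSolution κ ν t₀ u)
    {K : ℝ} (h0 : ∀ x, |u (t₀, x)| ≤ K)
    (h : ∀ t, t₀ ≤ t → ∀ x, |DeSitter.pderiv (Sum.inl ()) u (t, x)| ≤ C) {t : ℝ} (ht : t₀ ≤ t)
    (x : Space n) : |u (t, x)| ≤ K + C * (t - t₀) := by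
  have hd := fun s => hasDerivAt_slice (x := x) (hu.smooth.differentiable (by simp) (s, x))
  refine image_norm_le_of_norm_deriv_right_le_deriv_boundary (a := t₀) (b := t)
    (f := fun s => u (s, x)) (f' := fun s => DeSitter.pderiv (Sum.inl ()) u (s, x))
    (B := fun s => K + C * (s - t₀)) (B' := fun _ => C)
    (fun s _ => (hd s).continuousAt.continuousWithinAt) (fun s _ => (hd s).hasDerivWithinAt)
    (by simpa using h0 x) (fun s => ?_) (fun s hs => h s hs.1 x) (right_mem_Icc.2 ht)
  simpa using (((hasDerivAt_id s).sub_const t₀).const_mul C).const_add K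

/-- The bound on `∂ₜu` is integrable on `[t₀, ∞)`, so `u` stays bounded; this replaces the missing
mass term when `ν = 0`. -/
theorem IsSolution.le_of_exp_decay {κ ν t₀ C lam : ℝ} (hl : 0 < lam) (hC : 0 ≤ C)
    {u : Spacetime n → ℝ} (hu : IsSolution κ ν t₀ u)
    {K : ℝ} (h0 : ∀ x, |u (t₀, x)| ≤ K)
    (h : ∀ t, t₀ ≤ t → ∀ x, |DeSitter.pderiv (Sum.inl ()) u (t, x)| ≤ C * Real.exp (-lam * t))
    {t : ℝ} (ht : t₀ ≤ t) (x : Space n) :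
    |u (t, x)| ≤ K + C / lam * Real.exp (-lam * t₀) := by
  have hd := fun s => hasDerivAt_slice (x := x) (hu.smooth.differentiable (by simp) (s, x))
  have key : |u (t, x)| ≤ K + C / lam * Real.exp (-lam * t₀) - C / lam * Real.exp (-lam * t) := by
    refine image_norm_le_of_norm_deriv_right_le_deriv_boundary (a := t₀) (b := t)
      (f := fun s => u (s, x)) (f' := fun s => DeSitter.pderiv (Sum.inl ()) u (s, x))
      (B := fun s => K + C / lam * Real.exp (-lam * t₀) - C / lam * Real.exp (-lam * s))
      (B' := fun s => C * Real.exp (-lam * s))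
      (fun s _ => (hd s).continuousAt.continuousWithinAt) (fun s _ => (hd s).hasDerivWithinAt)
      (by simpa using h0 x) (fun s => ?_) (fun s hs => h s hs.1 x) (right_mem_Icc.2 ht)
    have := ((((hasDerivAt_id s).const_mul (-lam)).exp).const_mul (C / lam)).const_sub
      (K + C / lam * Real.exp (-lam * t₀))
    convert! this using 1
    simp only [id]
    field_simp
  have : 0 ≤ C / lam * Real.exp (-lam * t) := by positivity
  linarith

theorem sliceSupNorm_le {φ : Spacetime n → ℝ} {t B : ℝ} (h : ∀ x, |φ (t, x)| ≤ B) :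
    sliceSupNorm φ t ≤ ENNReal.ofReal B := by
  unfold sliceSupNorm
  rw [eLpNorm_exponent_top]
  exact eLpNormEssSup_le_of_ae_bound (Filter.Eventually.of_forall h)

theorem scaleFactor_rpow (t r : ℝ) : scaleFactor t ^ r = Real.exp (r * t) := by
  rw [scaleFactor, ← Real.exp_mul, mul_comm]

/-- Decay of the rescaled field `e^{ct} φ`. -/
theorem exists_rescaled_bounds {k : ℕ} (hk : (n : ℝ) / 2 + 2 < k) {m tStar t₀ : ℝ}
    (ht₀ : tStar < t₀) {φ₀ φ₁ : Space n → ℝ} (hφ₀ : MemH k φ₀) (hφ₁ : MemH (k - 1) φ₁)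
    {φ : Spacetime n → ℝ} (hsmooth : ContDiffOn ℝ ∞ φ (Ioi tStar ×ˢ univ))
    (hKG : ∀ t : ℝ, t₀ ≤ t → ∀ x : Space n,
      dAlembertian (deSitterMetric n) φ (t, x) - m ^ 2 * φ (t, x) = 0)
    (hinit₀ : ∀ x, φ (t₀, x) = φ₀ x)
    (hinit₁ : ∀ x, deriv (fun t : ℝ => φ (t, x)) t₀ = φ₁ x)
    {c κ ν lam : ℝ} (hc : 2 * c + 2 * κ = n) (hm : c ^ 2 + 2 * κ * c + ν ^ 2 = m ^ 2)
    (hl1 : lam ≤ 2 * κ) (hl2 : lam ≤ 1) (hl3 : lam * ν = 0) :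
    ∃ C, 0 ≤ C ∧ ∃ u : Spacetime n → ℝ, IsSolution κ ν t₀ u ∧ (∀ x, |u (t₀, x)| ≤ C) ∧
      ∀ t, t₀ ≤ t → ∀ x, φ (t, x) = Real.exp (-c * t) * u (t, x) ∧
        |pderiv (Sum.inl ()) u (t, x)| ≤ C * Real.exp (-lam * t) ∧
        |ν| * |u (t, x)| ≤ C * Real.exp (-lam * t) := by
  obtain ⟨Φ, hΦ, β, hβ, hΦφ⟩ := exists_contDiff_extension ht₀ hsmooth
  have hev : ∀ t, t₀ ≤ t → ∀ x, φ =ᶠ[nhds (t, x)] Φ := fun t ht x => by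
    have : {q : Spacetime n | β < q.1} ∈ nhds (t, x) :=
      (isOpen_lt continuous_const continuous_fst).mem_nhds (show β < t by linarith)
    filter_upwards [this] with q hq using (hΦφ q.1 hq q.2).symm
  have hsol := isSolution_exp_mul hΦ (t₀ := t₀) (fun t ht x => by
    rw [← dAlembertian_congr _ (hev t ht x), ← (hev t ht x).self_of_nhds]
    exact hKG t ht x) hc hm
  -- The energy already contains first derivatives, so data in `H^k × H^{k-1}` leave `s = k - 1`
  -- further spatial derivatives for the Sobolev inequality.
  obtain ⟨s, rfl⟩ : ∃ s, k = s + 1 := by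
    refine Nat.exists_eq_succ_of_ne_zero fun h => ?_
    rw [h] at hk
    have : (0 : ℝ) ≤ n := Nat.cast_nonneg n
    push_cast at hk
    linarith
  have hs : (n : ℝ) < 2 * s := by push_cast at hk; linarith
  have e0 : (fun x => Φ (t₀, x)) = φ₀ := funext fun x => by
    rw [hΦφ t₀ hβ, hinit₀]
  have e1 : (fun x => pderiv (Sum.inl ()) Φ (t₀, x)) = φ₁ := funext fun x => by
    rw [← hinit₁, ← (hasDerivAt_slice (hΦ.differentiable (by simp) (t₀, x))).deriv]
    refine Filter.EventuallyEq.deriv_eq ?_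
    filter_upwards [Ioi_mem_nhds hβ] with t ht using hΦφ t ht x
  have c0 := contDiff_slice hΦ t₀
  have c1 := contDiff_slice (contDiff_pderiv hΦ (Sum.inl ())) t₀
  have H0 : MemHs (s + 1) fun x => Φ (t₀, x) := MemHs.of_memH c0 (e0 ▸ hφ₀)
  have H1 : MemHs s fun x => pderiv (Sum.inl ()) Φ (t₀, x) := MemHs.of_memH c1 (e1 ▸ hφ₁)
  have hexp : ContDiff ℝ ∞ fun t : ℝ => Real.exp (c * t) :=
    Real.contDiff_exp.comp (contDiff_const.mul contDiff_id)
  have hd : HasDerivAt (fun t : ℝ => Real.exp (c * t)) (Real.exp (c * t₀) * c) t₀ := by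
    simpa using ((hasDerivAt_id t₀).const_mul c).exp
  have D0 : MemHs s fun x => Real.exp (c * t₀) * Φ (t₀, x) := H0.1.const_smul c0 _
  obtain ⟨C, hC0, hC⟩ := hsol.exists_bound hl1 hl2 hl3 hs D0
    (by
      have := MemHs.add (f := (Real.exp (c * t₀) * c) • fun x => Φ (t₀, x))
        (g := Real.exp (c * t₀) • fun x => pderiv (Sum.inl ()) Φ (t₀, x))
        (contDiff_const.smul c0) (contDiff_const.smul c1) (H0.1.const_smul c0 _)
        (H1.const_smul c1 _)
      convert this using 1
      ext x
      exact pderiv_time_mul_inl hΦ hexp hd)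
    (fun i => by
      have h := H0.2 i
      have hcd := contDiff_dx c0 i
      rw [dx_slice hΦ] at h hcd
      convert h.const_smul hcd (Real.exp (c * t₀)) using 1
      ext x
      exact pderiv_time_mul_inr hΦ hexp i (t₀, x))
  obtain ⟨K, hK⟩ := D0.bounded hs ((contDiff_const).mul c0)
  refine ⟨max C K, le_max_of_le_left hC0, _, hsol, fun x => (hK x).trans (le_max_right _ _),
    fun t ht x => ⟨?_, ?_, ?_⟩⟩
  · rw [(hev t ht x).self_of_nhds, ← mul_assoc, ← Real.exp_add]
    simp
  · exact (hC t ht x).1.trans (by gcongr; exact le_max_left _ _)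
  · exact (hC t ht x).2.trans (by gcongr; exact le_max_left _ _)

theorem abs_exp_mul_le {c t y B : ℝ} (h : |y| ≤ B) :
    |Real.exp (-c * t) * y| ≤ B * scaleFactor t ^ (-c) := by
  rw [scaleFactor_rpow, abs_mul, Real.abs_exp, mul_comm]
  gcongr

end DeSitter

end

/-! ### The three mass ranges -/

theorem theorem3 (n k : ℕ) (hn : 2 < n) (hk : (n : ℝ) / 2 + 2 < (k : ℝ))
    (m tStar t₀ : ℝ) (ht₀ : t₀ ∈ Ioi tStar)
    (φ₀ φ₁ : DeSitter.Space n → ℝ)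
    (hφ₀ : DeSitter.MemH k φ₀) (hφ₁ : DeSitter.MemH (k - 1) φ₁)
    (φ : DeSitter.Spacetime n → ℝ)
    (hsmooth : ContDiffOn ℝ ∞ φ (Ioi tStar ×ˢ univ))
    (hKG : ∀ t : ℝ, t₀ ≤ t → ∀ x : DeSitter.Space n,
      DeSitter.dAlembertian (DeSitter.deSitterMetric n) φ (t, x) - m ^ 2 * φ (t, x) = 0)
    (hinit₀ : ∀ x : DeSitter.Space n, φ (t₀, x) = φ₀ x)
    (hinit₁ : ∀ x : DeSitter.Space n, deriv (fun t : ℝ => φ (t, x)) t₀ = φ₁ x) :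
    ((n : ℝ) / 2 < |m| →
      ∃ C : ℝ, ∀ t : ℝ, t₀ ≤ t →
        DeSitter.sliceSupNorm φ t ≤
          ENNReal.ofReal (C * DeSitter.scaleFactor t ^ (-((n : ℝ) / 2)))) ∧
    (|m| = (n : ℝ) / 2 →
      (∃ C : ℝ, ∀ t : ℝ, t₀ ≤ t →
        DeSitter.sliceSupNorm φ t ≤
          ENNReal.ofReal (C * (DeSitter.scaleFactor t ^ (-((n : ℝ) / 2)) *
            (1 + |Real.log (DeSitter.scaleFactor t)|)))) ∧
      ∀ t₁ : ℝ, t₀ ≤ t₁ → 0 < t₁ →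
        ∃ C : ℝ, ∀ t : ℝ, t₁ ≤ t →
          DeSitter.sliceSupNorm φ t ≤
            ENNReal.ofReal (C * (DeSitter.scaleFactor t ^ (-((n : ℝ) / 2)) *
              Real.log (DeSitter.scaleFactor t)))) ∧
    (|m| < (n : ℝ) / 2 →
      ∃ C : ℝ, ∀ t : ℝ, t₀ ≤ t →
        DeSitter.sliceSupNorm φ t ≤
          ENNReal.ofReal (C * DeSitter.scaleFactor t ^
            (-((n : ℝ) / 2) + Real.sqrt ((n : ℝ) ^ 2 / 4 - m ^ 2)))) := by
  have hn0 : (0 : ℝ) ≤ n := Nat.cast_nonneg n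
  have hbounds := fun c κ ν lam => DeSitter.exists_rescaled_bounds hk ht₀ hφ₀ hφ₁ hsmooth hKG hinit₀ hinit₁
    (c := c) (κ := κ) (ν := ν) (lam := lam)
  have hm2 : m ^ 2 = |m| ^ 2 := (sq_abs m).symm
  refine ⟨fun h => ?_, fun h => ?_, fun h => ?_⟩
  · have hpos : 0 < m ^ 2 - (n : ℝ) ^ 2 / 4 := by rw [hm2]; nlinarith
    set ν := Real.sqrt (m ^ 2 - (n : ℝ) ^ 2 / 4) with hν
    have hν0 : 0 < ν := Real.sqrt_pos.2 hpos
    obtain ⟨C, hC0, u, -, -, hu⟩ := hbounds (n / 2) 0 ν 0 (by ring)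
      (by rw [hν, Real.sq_sqrt hpos.le]; ring) (by norm_num) (by norm_num) (by ring)
    refine ⟨C / ν, fun t ht => DeSitter.sliceSupNorm_le fun x => ?_⟩
    obtain ⟨h1, -, h3⟩ := hu t ht x
    rw [h1]
    refine DeSitter.abs_exp_mul_le ?_
    rw [le_div_iff₀ hν0]
    rw [abs_of_pos hν0] at h3
    simpa [mul_comm] using h3
  · have hsq : m ^ 2 = ((n : ℝ) / 2) ^ 2 := by rw [hm2, h]
    obtain ⟨C, hC0, u, hsol, h0, hu⟩ := hbounds (n / 2) 0 0 0 (by ring)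
      (by rw [hsq]; ring) (by norm_num) (by norm_num) (by ring)
    have hgrow : ∀ t, t₀ ≤ t → ∀ x, |u (t, x)| ≤ C * (1 + |t₀|) * (1 + |t|) := fun t ht x => by
      refine (hsol.le_add_mul h0 (fun t ht x => by simpa using (hu t ht x).2.1) ht x).trans ?_
      have e : t - t₀ ≤ |t| + |t₀| := by linarith [le_abs_self t, neg_abs_le t₀]
      have e2 : 1 + (t - t₀) ≤ (1 + |t₀|) * (1 + |t|) := by
        nlinarith [mul_nonneg (abs_nonneg t) (abs_nonneg t₀)]
      have := mul_le_mul_of_nonneg_left e2 hC0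
      linarith
    have hlog : ∀ t, Real.log (DeSitter.scaleFactor t) = t := fun t => Real.log_exp t
    refine ⟨⟨C * (1 + |t₀|), fun t ht => DeSitter.sliceSupNorm_le fun x => ?_⟩, fun t₁ ht₁ hpos =>
      ⟨C * (1 + |t₀|) * (1 / t₁ + 1), fun t ht => DeSitter.sliceSupNorm_le fun x => ?_⟩⟩
    · rw [(hu t ht x).1, hlog]
      exact (DeSitter.abs_exp_mul_le (hgrow t ht x)).trans (le_of_eq (by ring))
    · have ht' := ht₁.trans ht
      rw [(hu t ht' x).1, hlog]
      -- For `t ≥ t₁ > 0` the constant `1` is absorbed through `1 ≤ t / t₁`.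
      have e : 1 + |t| ≤ (1 / t₁ + 1) * t := by
        rw [abs_of_pos (hpos.trans_le ht), add_mul, one_mul, div_mul_eq_mul_div, one_mul]
        gcongr
        rwa [one_le_div hpos]
      have hb : |u (t, x)| ≤ C * (1 + |t₀|) * ((1 / t₁ + 1) * t) :=
        (hgrow t ht' x).trans (by gcongr)
      exact (DeSitter.abs_exp_mul_le hb).trans (le_of_eq (by ring))
  · have hpos : 0 < (n : ℝ) ^ 2 / 4 - m ^ 2 := by
      rw [hm2]; nlinarith [abs_nonneg m]
    set κ := Real.sqrt ((n : ℝ) ^ 2 / 4 - m ^ 2) with hκ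
    have hκ0 : 0 < κ := Real.sqrt_pos.2 hpos
    have hκ2 : κ ^ 2 = (n : ℝ) ^ 2 / 4 - m ^ 2 := Real.sq_sqrt hpos.le
    -- Here `c = n/2 - κ` is the smaller root of `c² - nc + m² = 0`, the slower decay rate; removing
    -- it leaves no mass term and friction `2κ > 0`, and `λ` is the largest weight the energy
    -- estimate allows.
    obtain ⟨C, hC0, u, hsol, h0, hu⟩ := hbounds (n / 2 - κ) κ 0 (min (2 * κ) 1) (by ring)
      (by linear_combination (-1 : ℝ) * hκ2) (min_le_left _ _) (min_le_right _ _) (by ring)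
    refine ⟨C + C / min (2 * κ) 1 * Real.exp (-min (2 * κ) 1 * t₀),
      fun t ht => DeSitter.sliceSupNorm_le fun x => ?_⟩
    rw [(hu t ht x).1, show -((n : ℝ) / 2) + κ = -((n : ℝ) / 2 - κ) by ring]
    exact DeSitter.abs_exp_mul_le (hsol.le_of_exp_decay (lt_min (by positivity) one_pos) hC0 h0
      (fun t ht x => (hu t ht x).2.1) ht x)
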